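/- Let $\mathcal{A}$ be an additive category with a (Quillen) exact structure $\mathcal{E}$. An ideal of $\mathcal{A}$ is an additive subfunctor of $\operatorname{Hom}$. For a class $\mathcal{M}$ of morphisms, ${}^{\perp}\mathcal{M}$ is the class of morphisms $g$ with $\operatorname{Ext}(g,m)=0$ for all $m\in\mathcal{M}$; $\operatorname{Ob}(\mathcal{M})$ is the class of objects $X$ with $1_X\in\mathcal{M}$. For an ordinal $\alpha$, an $\alpha$-system is a functor $\mathsf{F}\colon\alpha\to\mathcal{A}$, with objects $F_\beta$ ($\beta<\alpha$) and structural morphisms $f^\beta_\gamma\colon F_\beta\to F_\gamma$ ($\beta\le\gamma<\alpha$). It is continuous if $F_\beta=\varinjlim_{\gamma<\beta}F_\gamma$ (canonically) for every limit ordinal $\beta<\alpha$. An $\alpha$-composition of morphisms in a class $\mathcal{M}$ is the morphism $f^0_\alpha\colon F_0\to F_\alpha$ of a continuous $(\alpha+1)$-system with $f^\beta_{\beta+1}\in\mathcal{M}$ for all $\beta<\alpha$. For an ideal $\mathcal{J}$, the inductive power $\mathcal{J}^{(\alpha)}$ is the ideal generated by all $\alpha$-compositions of morphisms in $\mathcal{J}$.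 For a class $\mathcal{C}$ of objects, $\alpha\text{-}\mathrm{Filt}(\mathcal{C})$ is the class of objects isomorphic to $F_\alpha$ for some continuous $(\alpha+1)$-system with $F_0=0$ in which every $f^\beta_{\beta+1}$, $\beta<\alpha$, is an inflation with cokernel in $\mathcal{C}$. A $\mathcal{J}$-cosyzygy of an object $X$ is an object $W\in\operatorname{Ob}({}^{\perp}\mathcal{J})$ admitting a conflation $X\xrightarrow{\,j\,}Y\to W$ with $j\in\mathcal{J}$. The ideal $\mathcal{J}$ is object-special preenveloping if every object has a $\mathcal{J}$-cosyzygy. A $\mathcal{J}$-cosyzygy subcategory is a full subcategory closed under finite direct sums that contains a $\mathcal{J}$-cosyzygy of every object of $\mathcal{A}$. **Theorem.** Let $\lambda$ be an infinite ordinal such that for every ordinal $\alpha$ with $0<\alpha\le\lambda$, every continuous $\alpha$-system $\mathsf{F}$ whose morphisms $f^\beta_{\beta+1}$, $\beta+1<\alpha$, are inflations has a colimit, and the canonical morphism $F_0\to\varinjlim_{\beta<\alpha}F_\beta$ is an inflation. Let $\mathcal{J}$ be an object-special preenveloping ideal with a cosyzygy subcategory $\Omega^{-1}(\mathcal{J})$.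 Then $\mathcal{J}^{(\lambda)}$ is object-special preenveloping, and $\lambda\text{-}\mathrm{Filt}(\Omega^{-1}(\mathcal{J}))$ is a $\mathcal{J}^{(\lambda)}$-cosyzygy subcategory. If moreover $\Omega^{-1}(\mathcal{J})\subseteq\operatorname{Ob}({}^{\perp}\mathcal{J})$, then $\lambda\text{-}\mathrm{Filt}(\Omega^{-1}(\mathcal{J}))\subseteq\operatorname{Ob}({}^{\perp}(\mathcal{J}^{(\lambda)}))$. -/

import Mathlib

open CategoryTheory CategoryTheory.Limits

universe w v u

namespace IdealApprox

/-! ### Exact categories -/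

/-- A Quillen exact structure on an additive category: an isomorphism-closed class of
kernel-cokernel pairs `X₁ ⟶ X₂ ⟶ X₃` (the conflations) such that identities are inflations and
deflations, inflations and deflations are closed under composition, pushouts of inflations along
arbitrary morphisms exist and are inflations, and dually for deflations. -/
structure ExactStructure (A : Type u) [Category.{v} A] [Preadditive A] where
  /-- The distinguished kernel-cokernel pairs. -/
  IsConflation : ShortComplex A → Prop
  of_iso : ∀ {S T : ShortComplex A}, (S ≅ T) → IsConflation S → IsConflation T
  isKernel : ∀ {S : ShortComplex A}, IsConflation S →
    Nonempty (IsLimit (KernelFork.ofι S.f S.zero))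
  isCokernel : ∀ {S : ShortComplex A}, IsConflation S →
    Nonempty (IsColimit (CokernelCofork.ofπ S.g S.zero))
  inflation_id : ∀ X : A, ∃ (Z : A) (p : X ⟶ Z) (h : 𝟙 X ≫ p = 0),
    IsConflation (ShortComplex.mk (𝟙 X) p h)
  deflation_id : ∀ X : A, ∃ (K : A) (i : K ⟶ X) (h : i ≫ 𝟙 X = 0),
    IsConflation (ShortComplex.mk i (𝟙 X) h)
  inflation_comp : ∀ {X Y Z : A} (i : X ⟶ Y) (j : Y ⟶ Z),
    (∃ (C : A) (p : Y ⟶ C) (h : i ≫ p = 0), IsConflation (ShortComplex.mk i p h)) →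
    (∃ (C : A) (p : Z ⟶ C) (h : j ≫ p = 0), IsConflation (ShortComplex.mk j p h)) →
    ∃ (C : A) (p : Z ⟶ C) (h : (i ≫ j) ≫ p = 0), IsConflation (ShortComplex.mk (i ≫ j) p h)
  deflation_comp : ∀ {X Y Z : A} (p : X ⟶ Y) (q : Y ⟶ Z),
    (∃ (K : A) (i : K ⟶ X) (h : i ≫ p = 0), IsConflation (ShortComplex.mk i p h)) →
    (∃ (K : A) (i : K ⟶ Y) (h : i ≫ q = 0), IsConflation (ShortComplex.mk i q h)) →
    ∃ (K : A) (i : K ⟶ X) (h : i ≫ (p ≫ q) = 0), IsConflation (ShortComplex.mk i (p ≫ q) h)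
  inflation_pushout : ∀ {X Y X' : A} (i : X ⟶ Y) (f : X ⟶ X'),
    (∃ (C : A) (p : Y ⟶ C) (h : i ≫ p = 0), IsConflation (ShortComplex.mk i p h)) →
    ∃ (Y' : A) (f' : Y ⟶ Y') (i' : X' ⟶ Y'), IsPushout i f f' i' ∧
      ∃ (C : A) (p : Y' ⟶ C) (h : i' ≫ p = 0), IsConflation (ShortComplex.mk i' p h)
  deflation_pullback : ∀ {Y Z Z' : A} (p : Y ⟶ Z) (g : Z' ⟶ Z),
    (∃ (K : A) (i : K ⟶ Y) (h : i ≫ p = 0), IsConflation (ShortComplex.mk i p h)) →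
    ∃ (Y' : A) (g' : Y' ⟶ Y) (p' : Y' ⟶ Z'), IsPullback g' p' p g ∧
      ∃ (K : A) (i : K ⟶ Y') (h : i ≫ p' = 0), IsConflation (ShortComplex.mk i p' h)

section

variable {A : Type u} [Category.{v} A] [Preadditive A] (E : ExactStructure A)

/-- `i` is an inflation: the first morphism of a conflation. -/
def ExactStructure.Inflation {X Y : A} (i : X ⟶ Y) : Prop :=
  ∃ (C : A) (p : Y ⟶ C) (h : i ≫ p = 0), E.IsConflation (ShortComplex.mk i p h)

/-- A conflation `X ⟶ mid ⟶ C`, i.e. a representative of an element of `Ext(C, X)`. -/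
structure Conflation (C X : A) where
  mid : A
  i : X ⟶ mid
  p : mid ⟶ C
  zero : i ≫ p = 0
  isConflation : E.IsConflation (ShortComplex.mk i p zero)

variable {E}

/-- The conflation represents `0` in `Ext(C, X)`: its inflation is a section. -/
def Conflation.IsTrivial {C X : A} (ξ : Conflation E C X) : Prop :=
  ∃ r : ξ.mid ⟶ X, ξ.i ≫ r = 𝟙 X

/-- `η` is the pushout of `ξ` along `f : X ⟶ X'`, i.e. `Ext(C, f)[ξ] = [η]`. -/
def Conflation.IsPushoutAlong {C X X' : A} (ξ : Conflation E C X) (f : X ⟶ X')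
    (η : Conflation E C X') : Prop :=
  ∃ b : ξ.mid ⟶ η.mid, IsPushout ξ.i f b η.i ∧ b ≫ η.p = ξ.p

/-- `η` is the pullback of `ξ` along `g : C' ⟶ C`, i.e. `Ext(g, X)[ξ] = [η]`. -/
def Conflation.IsPullbackAlong {C C' X : A} (ξ : Conflation E C X) (g : C' ⟶ C)
    (η : Conflation E C' X) : Prop :=
  ∃ b : η.mid ⟶ ξ.mid, IsPullback b η.p ξ.p g ∧ η.i ≫ b = ξ.i

variable (E)

/-- `Ext(g, f) : Ext(C, X) ⟶ Ext(C', X')` is the zero map. -/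
def ExtMapEqZero {C C' X X' : A} (g : C' ⟶ C) (f : X ⟶ X') : Prop :=
  ∀ (ξ : Conflation E C X) (η : Conflation E C' X) (ζ : Conflation E C' X'),
    ξ.IsPullbackAlong g η → η.IsPushoutAlong f ζ → ζ.IsTrivial

/-- The class `⊥M` of all morphisms `g` with `Ext(g, m) = 0` for every `m` in `M`. -/
def leftPerp (M : MorphismProperty A) : MorphismProperty A :=
  fun _ _ g => ∀ ⦃X X' : A⦄ (m : X ⟶ X'), M m → ExtMapEqZero E g m

/-- The objects of a class of morphisms: those whose identity belongs to the class. -/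
def Ob (M : MorphismProperty A) : ObjectProperty A := fun X => M (𝟙 X)

end

/-! ### Ideals -/

/-- A (two-sided) ideal of a preadditive category: an additive subfunctor of `Hom`. -/
structure MorphismIdeal (A : Type u) [Category.{v} A] [Preadditive A] where
  hom : ∀ X Y : A, AddSubgroup (X ⟶ Y)
  comp_mem : ∀ {W X Y Z : A} (f : W ⟶ X) {g : X ⟶ Y} (h : Y ⟶ Z),
    g ∈ hom X Y → f ≫ g ≫ h ∈ hom W Z

section

variable {A : Type u} [Category.{v} A] [Preadditive A]

/-- The underlying class of morphisms of an ideal. -/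
def MorphismIdeal.toProperty (J : MorphismIdeal A) : MorphismProperty A :=
  fun X Y f => f ∈ J.hom X Y

/-- The ideal generated by a class of morphisms: the intersection of all ideals containing it. -/
def MorphismIdeal.generatedBy (M : MorphismProperty A) : MorphismIdeal A where
  hom X Y :=
    { carrier := {f | ∀ I : MorphismIdeal A, M ≤ I.toProperty → f ∈ I.hom X Y}
      zero_mem' := fun I _ => (I.hom X Y).zero_mem
      add_mem' := fun hf hg I hI => (I.hom X Y).add_mem (hf I hI) (hg I hI)
      neg_mem' := fun hf I hI => (I.hom X Y).neg_mem (hf I hI) }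
  comp_mem := fun f _ h hg I hI => I.comp_mem f h (hg I hI)

end

/-! ### Systems indexed by ordinals -/

/-- A directed `α`-system: a functor to `A` from the ordinal `α`, i.e. from the well-ordered set
of ordinals `< α`. It is continuous when it satisfies `Functor.IsWellOrderContinuous`. -/
abbrev OrdSystem (A : Type u) [Category.{v} A] (α : Ordinal.{w}) := Set.Iio α ⥤ A

section

variable {A : Type u} [Category.{v} A]

/-- The structural morphism of a system from index `β` to index `γ`. -/
def OrdSystem.tr {α : Ordinal.{w}} (F : OrdSystem A α) {β γ : Ordinal.{w}} (h : β ≤ γ)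
    (hγ : γ < α) : F.obj ⟨β, h.trans_lt hγ⟩ ⟶ F.obj ⟨γ, hγ⟩ :=
  F.map (homOfLE (show (⟨β, h.trans_lt hγ⟩ : Set.Iio α) ≤ ⟨γ, hγ⟩ from h))

/-- `f` is (up to isomorphism) an `α`-composition of morphisms in `M`: the morphism from index `0`
to index `α` in a continuous `(α + 1)`-system whose successive structural morphisms are in `M`. -/
def IsOrdComposition (M : MorphismProperty A) (α : Ordinal.{w}) : MorphismProperty A :=
  fun _ _ f => ∃ F : OrdSystem A (Order.succ α), F.IsWellOrderContinuous ∧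
    (∀ (β : Ordinal.{w}) (h : Order.succ β < Order.succ α), M (F.tr (Order.le_succ β) h)) ∧
    Nonempty (Arrow.mk f ≅ Arrow.mk (F.tr (zero_le (a := α)) (Order.lt_succ α)))

end

section

variable {A : Type u} [Category.{v} A] [Preadditive A]

/-- The `α`-th inductive power of an ideal: the ideal generated by all `α`-compositions of
morphisms in it. -/
def MorphismIdeal.inductivePower (J : MorphismIdeal A) (α : Ordinal.{w}) : MorphismIdeal A :=
  MorphismIdeal.generatedBy (IsOrdComposition J.toProperty α)

variable (E : ExactStructure A)

/-- `α`-compositions of inflations exist and are inflations: every continuous `α`-system whose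
successive structural morphisms are inflations has a colimit, and the canonical morphism from its
`0`-th object to the colimit is an inflation. -/
def ExactStructure.HasInflationCompositions (α : Ordinal.{w}) : Prop :=
  ∀ F : OrdSystem A α, F.IsWellOrderContinuous →
    (∀ (β : Ordinal.{w}) (h : Order.succ β < α), E.Inflation (F.tr (Order.le_succ β) h)) →
    ∃ c : Cocone F, Nonempty (IsColimit c) ∧
      ∀ h : (0 : Ordinal.{w}) < α, E.Inflation (c.ι.app ⟨0, h⟩)

/-- `α-Filt(P)`: the objects `C` having an `α`-filtration in `P`, i.e. a continuous
`(α + 1)`-system starting at a zero object and ending at `C`, whose successive structural morphisms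
are inflations with cokernel in `P`. -/
def ExactStructure.Filt (α : Ordinal.{w}) (P : ObjectProperty A) : ObjectProperty A :=
  fun C => ∃ F : OrdSystem A (Order.succ α), F.IsWellOrderContinuous ∧
    IsZero (F.obj ⟨0, (zero_le (a := α)).trans_lt (Order.lt_succ α)⟩) ∧
    (∀ (β : Ordinal.{w}) (h : Order.succ β < Order.succ α),
      ∃ (Q : A) (p : F.obj ⟨Order.succ β, h⟩ ⟶ Q) (hp : F.tr (Order.le_succ β) h ≫ p = 0),
        P Q ∧ E.IsConflation (ShortComplex.mk (F.tr (Order.le_succ β) h) p hp)) ∧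
    Nonempty (F.obj ⟨α, Order.lt_succ α⟩ ≅ C)

/-! ### Object-special preenveloping ideals -/

/-- `W` is a `J`-cosyzygy of `X`: it is an object of `⊥J`, and there is a conflation
`X ⟶ Y ⟶ W` whose inflation is in `J`. -/
def IsCosyzygy (J : MorphismIdeal A) (X W : A) : Prop :=
  Ob (leftPerp E J.toProperty) W ∧ ∃ ξ : Conflation E W X, J.toProperty ξ.i

/-- `J` is object-special preenveloping: every object has a `J`-cosyzygy. -/
def IsObjectSpecialPreenveloping (J : MorphismIdeal A) : Prop :=
  ∀ X : A, ∃ W : A, IsCosyzygy E J X W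

/-- A `J`-cosyzygy subcategory: it is closed under finite direct sums and contains a `J`-cosyzygy
of every object. -/
def IsCosyzygySubcategory (J : MorphismIdeal A) (P : ObjectProperty A) : Prop :=
  P.IsClosedUnderFiniteProducts ∧ ∀ X : A, ∃ W : A, P W ∧ IsCosyzygy E J X W

end

end IdealApprox

namespace IdealApprox

/-! ### Exact categories -/

section Exact

variable {A : Type u} [Category.{v} A] [Preadditive A] {E : ExactStructure A}

lemma Conflation.exists_desc {C X : A} (ξ : Conflation E C X) {T : A} (k : ξ.mid ⟶ T)
    (hk : ξ.i ≫ k = 0) : ∃ l : C ⟶ T, ξ.p ≫ l = k := by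
  obtain ⟨h⟩ := E.isCokernel ξ.isConflation
  exact ⟨h.desc (CokernelCofork.ofπ k hk), h.fac (CokernelCofork.ofπ k hk) .one⟩

lemma Conflation.epi_p {C X : A} (ξ : Conflation E C X) : Epi ξ.p := by
  obtain ⟨h⟩ := E.isCokernel ξ.isConflation
  exact ⟨fun a b hab => Cofork.IsColimit.hom_ext h hab⟩

lemma Conflation.exists_lift {C X : A} (ξ : Conflation E C X) {T : A} (k : T ⟶ ξ.mid)
    (hk : k ≫ ξ.p = 0) : ∃ l : T ⟶ X, l ≫ ξ.i = k := by
  obtain ⟨h⟩ := E.isKernel ξ.isConflation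
  exact ⟨h.lift (KernelFork.ofι k hk), h.fac (KernelFork.ofι k hk) .zero⟩

lemma Conflation.mono_i {C X : A} (ξ : Conflation E C X) : Mono ξ.i := by
  obtain ⟨h⟩ := E.isKernel ξ.isConflation
  exact ⟨fun a b hab => Fork.IsLimit.hom_ext h hab⟩

/-- `p` is a cokernel of `i`. -/
structure IsCoker {X Y C : A} (i : X ⟶ Y) (p : Y ⟶ C) : Prop where
  zero : i ≫ p = 0
  epi : Epi p
  exists_desc : ∀ {T : A} (k : Y ⟶ T), i ≫ k = 0 → ∃ l : C ⟶ T, p ≫ l = k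

/-- `i` is a kernel of `p`. -/
structure IsKer {X Y C : A} (i : X ⟶ Y) (p : Y ⟶ C) : Prop where
  zero : i ≫ p = 0
  mono : Mono i
  exists_lift : ∀ {T : A} (k : T ⟶ Y), k ≫ p = 0 → ∃ l : T ⟶ X, l ≫ i = k

lemma Conflation.isCoker {C X : A} (ξ : Conflation E C X) : IsCoker ξ.i ξ.p :=
  ⟨ξ.zero, ξ.epi_p, ξ.exists_desc⟩

lemma Conflation.isKer {C X : A} (ξ : Conflation E C X) : IsKer ξ.i ξ.p :=
  ⟨ξ.zero, ξ.mono_i, ξ.exists_lift⟩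

variable (E) in
/-- `i` and `p` form a conflation. -/
def IsConfl {X Y C : A} (i : X ⟶ Y) (p : Y ⟶ C) : Prop :=
  ∃ h : i ≫ p = 0, E.IsConflation (ShortComplex.mk i p h)

lemma Conflation.isConfl {C X : A} (ξ : Conflation E C X) : IsConfl E ξ.i ξ.p :=
  ⟨ξ.zero, ξ.isConflation⟩

/-- The conflation given by two morphisms that form one. -/
@[simps]
def IsConfl.toConflation {X Y C : A} {i : X ⟶ Y} {p : Y ⟶ C} (h : IsConfl E i p) :
    Conflation E C X := ⟨Y, i, p, h.1, h.2⟩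

section

variable {X Y C : A} {i : X ⟶ Y} {p : Y ⟶ C} (h : IsConfl E i p)
include h

lemma IsConfl.isCoker : IsCoker i p := h.toConflation.isCoker
lemma IsConfl.isKer : IsKer i p := h.toConflation.isKer
lemma IsConfl.inflation : E.Inflation i := ⟨C, p, h.1, h.2⟩

lemma IsConfl.of_isos {X' Y' C' : A} {i' : X' ⟶ Y'} {p' : Y' ⟶ C'} (e₁ : X ≅ X') (e₂ : Y ≅ Y')
    (e₃ : C ≅ C') (h₁ : e₁.hom ≫ i' = i ≫ e₂.hom) (h₂ : e₂.hom ≫ p' = p ≫ e₃.hom) :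
    IsConfl E i' p' := by
  have hz : i' ≫ p' = 0 := by
    rw [← cancel_epi e₁.hom, reassoc_of% h₁, h₂, reassoc_of% h.1]
    simp
  exact ⟨hz, E.of_iso (ShortComplex.isoMk e₁ e₂ e₃ h₁ h₂) h.2⟩

end

lemma ExactStructure.Inflation.exists_isConfl {X Y : A} {i : X ⟶ Y} (h : E.Inflation i) :
    ∃ (C : A) (p : Y ⟶ C), IsConfl E i p := by
  obtain ⟨C, p, h, h'⟩ := h
  exact ⟨C, p, h, h'⟩

lemma IsCoker.exists_iso {X Y C C' : A} {i : X ⟶ Y} {p : Y ⟶ C} {p' : Y ⟶ C'} (h : IsCoker i p)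
    (h' : IsCoker i p') : ∃ e : C ≅ C', p ≫ e.hom = p' := by
  obtain ⟨a, ha⟩ := h.exists_desc p' h'.zero
  obtain ⟨b, hb⟩ := h'.exists_desc p h.zero
  have := h.epi
  have := h'.epi
  refine ⟨⟨a, b, ?_, ?_⟩, ha⟩
  · rw [← cancel_epi p, reassoc_of% ha, hb, Category.comp_id]
  · rw [← cancel_epi p', reassoc_of% hb, ha, Category.comp_id]

lemma IsKer.exists_iso {X X' Y C : A} {i : X ⟶ Y} {i' : X' ⟶ Y} {p : Y ⟶ C} (h : IsKer i p)
    (h' : IsKer i' p) : ∃ e : X ≅ X', e.hom ≫ i' = i := by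
  obtain ⟨a, ha⟩ := h'.exists_lift i h.zero
  obtain ⟨b, hb⟩ := h.exists_lift i' h'.zero
  have := h.mono
  have := h'.mono
  refine ⟨⟨a, b, ?_, ?_⟩, ha⟩
  · rw [← cancel_mono i, Category.assoc, hb, ha, Category.id_comp]
  · rw [← cancel_mono i', Category.assoc, ha, hb, Category.id_comp]

lemma ExactStructure.Inflation.isConfl {X Y C : A} {i : X ⟶ Y} {p : Y ⟶ C} (h : E.Inflation i)
    (hp : IsCoker i p) : IsConfl E i p := by
  obtain ⟨C', p', h'⟩ := h.exists_isConfl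
  obtain ⟨e, he⟩ := h'.isCoker.exists_iso hp
  exact h'.of_isos (Iso.refl _) (Iso.refl _) e (by simp) (by simp [he])

/-- `p` is a deflation: the second morphism of a conflation. -/
def ExactStructure.Deflation (E : ExactStructure A) {Y C : A} (p : Y ⟶ C) : Prop :=
  ∃ (X : A) (i : X ⟶ Y) (h : i ≫ p = 0), E.IsConflation (ShortComplex.mk i p h)

lemma IsConfl.deflation {X Y C : A} {i : X ⟶ Y} {p : Y ⟶ C} (h : IsConfl E i p) :
    E.Deflation p := ⟨X, i, h.1, h.2⟩

lemma ExactStructure.Deflation.isConfl {X Y C : A} {i : X ⟶ Y} {p : Y ⟶ C} (h : E.Deflation p)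
    (hp : IsKer i p) : IsConfl E i p := by
  obtain ⟨X', i', h1, h2⟩ := h
  have h' : IsConfl E i' p := ⟨h1, h2⟩
  obtain ⟨e, he⟩ := h'.isKer.exists_iso hp
  exact h'.of_isos e (Iso.refl _) (Iso.refl _) (by simp [he]) (by simp)

lemma ExactStructure.Inflation.comp {X Y Z : A} {i : X ⟶ Y} {j : Y ⟶ Z} (hi : E.Inflation i)
    (hj : E.Inflation j) : E.Inflation (i ≫ j) :=
  E.inflation_comp i j hi hj

lemma ExactStructure.Inflation.of_arrow_iso {X Y X' Y' : A} {i : X ⟶ Y} {i' : X' ⟶ Y'}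
    (h : E.Inflation i) (e₁ : X ≅ X') (e₂ : Y ≅ Y') (h₁ : e₁.hom ≫ i' = i ≫ e₂.hom) :
    E.Inflation i' := by
  obtain ⟨C, p, h⟩ := h.exists_isConfl
  exact (h.of_isos (p' := e₂.inv ≫ p) e₁ e₂ (Iso.refl _) h₁ (by simp)).inflation

lemma ExactStructure.inflation_of_isIso {X Y : A} (i : X ⟶ Y) [IsIso i] : E.Inflation i :=
  ExactStructure.Inflation.of_arrow_iso (E.inflation_id X) (Iso.refl X) (asIso i) (by simp)

lemma ExactStructure.Inflation.of_isPushout {X Y X' Y' : A} {i : X ⟶ Y} {f : X ⟶ X'}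
    {f' : Y ⟶ Y'} {i' : X' ⟶ Y'} (h : E.Inflation i) (sq : IsPushout i f f' i') :
    E.Inflation i' := by
  obtain ⟨Y'', f'', i'', sq', h'⟩ := E.inflation_pushout i f h
  exact ExactStructure.Inflation.of_arrow_iso h' (Iso.refl _) (sq'.isoIsPushout _ _ sq)
    (by simp)

lemma ExactStructure.Deflation.of_isPullback {Y Z Z' Y' : A} {p : Y ⟶ Z} {g : Z' ⟶ Z}
    {g' : Y' ⟶ Y} {p' : Y' ⟶ Z'} (h : E.Deflation p) (sq : IsPullback g' p' p g) :
    E.Deflation p' := by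
  obtain ⟨Y'', g'', p'', sq', K, k, hk, h'⟩ := E.deflation_pullback p g h
  have h'' : IsConfl E k p'' := ⟨hk, h'⟩
  exact (h''.of_isos (i' := k ≫ (sq'.isoIsPullback _ _ sq).hom) (Iso.refl _)
    (sq'.isoIsPullback _ _ sq) (Iso.refl _) (by simp) (by simp)).deflation

lemma IsCoker.of_isPushout {X Y C X' Y' : A} {i : X ⟶ Y} {p : Y ⟶ C} {f : X ⟶ X'}
    {f' : Y ⟶ Y'} {i' : X' ⟶ Y'} (h : IsCoker i p) (sq : IsPushout i f f' i') :
    ∃ p' : Y' ⟶ C, f' ≫ p' = p ∧ IsCoker i' p' := by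
  have := h.epi
  refine ⟨sq.desc p 0 (by simp [h.zero]), by simp, by simp,
    epi_of_epi_fac (sq.inl_desc p 0 (by simp [h.zero])), fun k hk => ?_⟩
  obtain ⟨l, hl⟩ := h.exists_desc (f' ≫ k) (by rw [reassoc_of% sq.w, hk, comp_zero])
  exact ⟨l, sq.hom_ext (by simp [hl]) (by simp [hk])⟩

lemma IsConfl.of_isPushout {X Y C X' Y' : A} {i : X ⟶ Y} {p : Y ⟶ C} {f : X ⟶ X'}
    {f' : Y ⟶ Y'} {i' : X' ⟶ Y'} (h : IsConfl E i p) (sq : IsPushout i f f' i') :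
    ∃ p' : Y' ⟶ C, f' ≫ p' = p ∧ IsConfl E i' p' := by
  obtain ⟨p', h₁, h₂⟩ := h.isCoker.of_isPushout sq
  exact ⟨p', h₁, (h.inflation.of_isPushout sq).isConfl h₂⟩

lemma IsKer.of_isPullback {X Y Z Z' Y' : A} {i : X ⟶ Y} {p : Y ⟶ Z} {g : Z' ⟶ Z}
    {g' : Y' ⟶ Y} {p' : Y' ⟶ Z'} (h : IsKer i p) (sq : IsPullback g' p' p g) :
    ∃ i' : X ⟶ Y', i' ≫ g' = i ∧ IsKer i' p' := by
  have := h.mono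
  refine ⟨sq.lift i 0 (by simp [h.zero]), by simp, by simp,
    mono_of_mono_fac (sq.lift_fst i 0 (by simp [h.zero])), fun k hk => ?_⟩
  obtain ⟨l, hl⟩ := h.exists_lift (k ≫ g') (by
    rw [Category.assoc, sq.w, reassoc_of% hk, zero_comp])
  exact ⟨l, sq.hom_ext (by simp [hl]) (by simp [hk])⟩

lemma IsConfl.of_isPullback {X Y Z Z' Y' : A} {i : X ⟶ Y} {p : Y ⟶ Z} {g : Z' ⟶ Z}
    {g' : Y' ⟶ Y} {p' : Y' ⟶ Z'} (h : IsConfl E i p) (sq : IsPullback g' p' p g) :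
    ∃ i' : X ⟶ Y', i' ≫ g' = i ∧ IsConfl E i' p' := by
  obtain ⟨i', h₁, h₂⟩ := h.isKer.of_isPullback sq
  exact ⟨i', h₁, (h.deflation.of_isPullback sq).isConfl h₂⟩

/-- A short five lemma. -/
lemma IsConfl.isIso_of_comp_eq {X Z M C : A} {i : X ⟶ Z} {q : Z ⟶ C} {j : X ⟶ M} {p : M ⟶ C}
    (h : IsConfl E i q) (h' : IsConfl E j p) (b : Z ⟶ M) (hi : i ≫ b = j) (hp : b ≫ p = q) :
    IsIso b := by
  obtain ⟨Q, g, p', sq, -⟩ := E.deflation_pullback q p h.deflation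
  obtain ⟨k, hk, hk'⟩ := h.of_isPullback sq
  have := h'.isKer.mono
  have := hk'.isCoker.epi
  obtain ⟨r, hr⟩ := h'.isKer.exists_lift (p' - g ≫ b) (by simp [hp, sq.w])
  have hkr : k ≫ r = -𝟙 X := by
    rw [← cancel_mono j, Category.assoc, hr]
    simp [hk'.1, reassoc_of% hk, hi]
  obtain ⟨s, hs⟩ := hk'.isCoker.exists_desc (g + r ≫ i) (by simp [hk, reassoc_of% hkr])
  have ht := sq.lift_fst (𝟙 Z) b (by simp [hp])
  have ht' := sq.lift_snd (𝟙 Z) b (by simp [hp])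
  set t := sq.lift (𝟙 Z) b (by simp [hp])
  have htr : t ≫ r = 0 := by
    rw [← cancel_mono j, Category.assoc, hr]
    simp [ht', reassoc_of% ht]
  refine ⟨s, ?_, ?_⟩
  · rw [← ht', Category.assoc, hs]
    simp [ht, reassoc_of% htr]
  · rw [← cancel_epi p', reassoc_of% hs]
    simp [hi, hr]

/-- Noether's isomorphism theorem: if `i` and `j` are inflations then the cokernels of `i`, `i ≫ j`
and `j` form a conflation. -/
lemma IsConfl.noether {X Y Z C D W : A} {i : X ⟶ Y} {j : Y ⟶ Z} {p : Y ⟶ C} {q : Z ⟶ D}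
    {r : Z ⟶ W} (hi : IsCoker i p) (hij : IsCoker (i ≫ j) q) (hj : IsConfl E j r) (c : C ⟶ D)
    (hc : p ≫ c = j ≫ q) : ∃ d : D ⟶ W, q ≫ d = r ∧ IsConfl E c d := by
  have := hi.epi
  have := hij.epi
  have sq : IsPushout j p q c := by
    have key : ∀ s : PushoutCocone j p, ∃ l : D ⟶ s.pt, q ≫ l = s.inl := fun s =>
      hij.exists_desc s.inl (by
        rw [Category.assoc, s.condition, reassoc_of% hi.zero, zero_comp])
    choose l hl using key
    refine ⟨⟨hc.symm⟩, ⟨PushoutCocone.IsColimit.mk _ l hl (fun s => ?_) (fun s m hm _ => ?_)⟩⟩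
    · rw [← cancel_epi p, reassoc_of% hc, hl, s.condition]
    · rw [← cancel_epi q, hm, hl]
  exact hj.of_isPushout sq

/-- Pulling back a conflation along an inflation `c` yields an inflation with the same cokernel. -/
lemma IsConfl.of_isPullback_inflation {M N C D W : A} {c : C ⟶ D} {d : D ⟶ W} {q : N ⟶ D}
    {b : M ⟶ N} {p : M ⟶ C} (h : IsConfl E c d) (hq : E.Deflation q)
    (sq : IsPullback b p q c) : IsConfl E b (q ≫ d) := by
  refine ExactStructure.Deflation.isConfl (E.deflation_comp q d hq h.deflation) ?_
  have := h.isKer.mono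
  refine ⟨by rw [reassoc_of% sq.w, h.1, comp_zero], ⟨fun x y hxy => sq.hom_ext hxy ?_⟩,
    fun k hk => ?_⟩
  · rw [← cancel_mono c, Category.assoc, ← sq.w, reassoc_of% hxy, Category.assoc, sq.w]
  · obtain ⟨l, hl⟩ := h.isKer.exists_lift (k ≫ q) (by simpa using hk)
    exact ⟨sq.lift k l hl.symm, by simp⟩

/-- A kernel of a morphism to a zero object is an isomorphism. -/
lemma IsKer.isIso_of_isZero {X Y C : A} {i : X ⟶ Y} {p : Y ⟶ C} (h : IsKer i p) (hC : IsZero C) :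
    IsIso i := by
  obtain ⟨l, hl⟩ := h.exists_lift (𝟙 Y) (hC.eq_of_tgt _ _)
  have := h.mono
  exact ⟨l, by rw [← cancel_mono i, Category.assoc, hl]; simp, hl⟩

/-- `Ext(W, M) = 0` says that every conflation ending in `W` is extendable along morphisms of
`M`. -/
lemma ob_leftPerp_iff {M : MorphismProperty A} {W : A} :
    Ob (leftPerp E M) W ↔ ∀ ⦃X X' : A⦄ (m : X ⟶ X'), M m → ∀ ⦃Y : A⦄ (i : X ⟶ Y) (p : Y ⟶ W),
      IsConfl E i p → ∃ h : Y ⟶ X', i ≫ h = m := by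
  constructor
  · intro hW X X' m hm Y i p hip
    obtain ⟨Y', f', i', sq, -⟩ := E.inflation_pushout i m hip.inflation
    obtain ⟨p', hp', hc⟩ := hip.of_isPushout sq
    have sq' : IsPullback (𝟙 Y) p p (𝟙 W) := IsPullback.of_horiz_isIso ⟨by simp⟩
    obtain ⟨r, hr⟩ : ∃ r : Y' ⟶ X', i' ≫ r = 𝟙 X' :=
      hW m hm hip.toConflation hip.toConflation hc.toConflation
        ⟨𝟙 Y, sq', Category.comp_id i⟩ ⟨f', sq, hp'⟩
    exact ⟨f' ≫ r, by rw [reassoc_of% sq.w, hr, Category.comp_id]⟩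
  · intro hW X X' m hm ξ η ζ _ ⟨b, sq, _⟩
    obtain ⟨h, hh⟩ := hW m hm η.i η.p η.isConfl
    exact ⟨sq.desc h (𝟙 _) (by simp [hh]), by simp⟩

/-- Zero objects form the conflation `0 ⟶ 0 ⟶ 0`. -/
lemma isConfl_of_isZero {X Y C : A} (hX : IsZero X) (hY : IsZero Y) (hC : IsZero C) (i : X ⟶ Y)
    (p : Y ⟶ C) : IsConfl E i p := by
  obtain ⟨Z, q, h⟩ := ExactStructure.Inflation.exists_isConfl (E.inflation_id X)
  have hZ : IsZero Z := by
    have := h.isCoker.epi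
    rw [IsZero.iff_id_eq_zero, ← cancel_epi q]
    exact hX.eq_of_src _ _
  exact h.of_isos (Iso.refl _) (hX.iso hY) (hZ.iso hC) (hX.eq_of_src _ _) (hX.eq_of_src _ _)

/-- Direct sums of conflations are conflations. -/
lemma IsConfl.biprod [HasBinaryBiproducts A] {X Y C X' Y' C' : A} {i : X ⟶ Y} {p : Y ⟶ C}
    {i' : X' ⟶ Y'} {p' : Y' ⟶ C'} (h : IsConfl E i p) (h' : IsConfl E i' p') :
    IsConfl E (biprod.map i i') (biprod.map p p') := by
  have sq₁ : IsPushout i (biprod.inl : X ⟶ X ⊞ X') biprod.inl (biprod.map i (𝟙 X')) := by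
    refine ⟨⟨by simp⟩, ⟨PushoutCocone.IsColimit.mk _
      (fun s => biprod.desc s.inl (biprod.inr ≫ s.inr)) (fun s => by simp) (fun s => ?_)
      (fun s m hm hm' => ?_)⟩⟩
    · ext <;> simp [s.condition]
    · ext <;> simp [← hm, ← hm']
  have sq₂ : IsPushout i' (biprod.inr : X' ⟶ Y ⊞ X') biprod.inr (biprod.map (𝟙 Y) i') := by
    refine ⟨⟨by simp⟩, ⟨PushoutCocone.IsColimit.mk _
      (fun s => biprod.desc (biprod.inl ≫ s.inr) s.inl) (fun s => by simp) (fun s => ?_)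
      (fun s m hm hm' => ?_)⟩⟩
    · ext <;> simp [s.condition]
    · ext <;> simp [← hm, ← hm']
  have hinf := (h.inflation.of_isPushout sq₁).comp (h'.inflation.of_isPushout sq₂)
  have e : biprod.map i (𝟙 X') ≫ biprod.map (𝟙 Y) i' = biprod.map i i' := by ext <;> simp
  rw [e] at hinf
  have := h.isCoker.epi
  have := h'.isCoker.epi
  refine hinf.isConfl ⟨by ext <;> simp [reassoc_of% h.1, reassoc_of% h'.1], ⟨fun a b hab => ?_⟩,
    fun k hk => ?_⟩
  · ext
    · rw [← cancel_epi p]; simpa using biprod.inl ≫= hab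
    · rw [← cancel_epi p']; simpa using biprod.inr ≫= hab
  · obtain ⟨l, hl⟩ := h.isCoker.exists_desc (biprod.inl ≫ k) (by
      simpa using biprod.inl ≫= hk)
    obtain ⟨l', hl'⟩ := h'.isCoker.exists_desc (biprod.inr ≫ k) (by
      simpa using biprod.inr ≫= hk)
    exact ⟨biprod.desc l l', by ext <;> simp [hl, hl']⟩

end Exact

/-! ### Systems indexed by ordinals -/

/-- An `α`-system with objects and morphisms unbundled from the subtype `Set.Iio α`. -/
structure Tower (A : Type u) [Category.{v} A] (α : Ordinal.{w}) where
  obj : ∀ β, β < α → A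
  map : ∀ {β γ} (h : β ≤ γ) (hγ : γ < α), obj β (h.trans_lt hγ) ⟶ obj γ hγ
  map_self : ∀ {β} (h : β ≤ β) (hβ : β < α), map h hβ = 𝟙 (obj β hβ)
  map_map : ∀ {β γ δ} (h : β ≤ γ) (h' : γ ≤ δ) (hδ : δ < α),
    map h (h'.trans_lt hδ) ≫ map h' hδ = map (h.trans h') hδ

attribute [simp] Tower.map_self Tower.map_map

section Tower

variable {A : Type u} [Category.{v} A] {α : Ordinal.{w}}

@[simp]
lemma Tower.map_map_comp (F : Tower A α) {β γ δ : Ordinal.{w}} (h : β ≤ γ) (h' : γ ≤ δ)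
    (hδ : δ < α) {Z : A} (k : F.obj δ hδ ⟶ Z) :
    F.map h (h'.trans_lt hδ) ≫ F.map h' hδ ≫ k = F.map (h.trans h') hδ ≫ k := by
  rw [← Category.assoc, F.map_map]

/-- The tower underlying a system. -/
@[simps]
def OrdSystem.toTower (F : OrdSystem A α) : Tower A α where
  obj β hβ := F.obj ⟨β, hβ⟩
  map h hγ := F.tr h hγ
  map_self _ _ := F.map_id _
  map_map _ _ _ := (F.map_comp _ _).symm

/-- The system given by a tower. -/
def Tower.toSystem (F : Tower A α) : OrdSystem A α where
  obj β := F.obj β.1 β.2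
  map {_ γ} f := F.map (leOfHom f) γ.2
  map_id _ := F.map_self _ _
  map_comp _ _ := (F.map_map _ _ _).symm

/-- The restriction of a tower to a smaller ordinal. -/
@[simps]
def Tower.restrict (F : Tower A α) {β : Ordinal.{w}} (hβ : β ≤ α) : Tower A β where
  obj γ hγ := F.obj γ (hγ.trans_le hβ)
  map h hγ := F.map h (hγ.trans_le hβ)
  map_self _ _ := F.map_self _ _
  map_map _ _ _ := F.map_map _ _ _

/-- A cocone under the stages below `β`. -/
def Tower.IsCompatible (F : Tower A α) {β : Ordinal.{w}} (hβ : β ≤ α) {Z : A}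
    (s : ∀ γ (hγ : γ < β), F.obj γ (hγ.trans_le hβ) ⟶ Z) : Prop :=
  ∀ γ δ (h : γ ≤ δ) (hδ : δ < β), F.map h (hδ.trans_le hβ) ≫ s δ hδ = s γ (h.trans_lt hδ)

/-- A cocone that is a colimit of the stages below `β`. -/
structure Tower.IsColim (F : Tower A α) {β : Ordinal.{w}} (hβ : β ≤ α) {Z : A}
    (s : ∀ γ (hγ : γ < β), F.obj γ (hγ.trans_le hβ) ⟶ Z) : Prop where
  compatible : F.IsCompatible hβ s
  exists_desc : ∀ {T : A} (t : ∀ γ (hγ : γ < β), F.obj γ (hγ.trans_le hβ) ⟶ T),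
    F.IsCompatible hβ t → ∃ d : Z ⟶ T, ∀ γ (hγ : γ < β), s γ hγ ≫ d = t γ hγ
  hom_ext : ∀ {T : A} {a b : Z ⟶ T}, (∀ γ (hγ : γ < β), s γ hγ ≫ a = s γ hγ ≫ b) → a = b

/-- Two colimits of the stages below `β` are isomorphic. -/
lemma Tower.IsColim.exists_iso {F : Tower A α} {β : Ordinal.{w}} {hβ : β ≤ α} {Z Z' : A}
    {s : ∀ γ (hγ : γ < β), F.obj γ (hγ.trans_le hβ) ⟶ Z}
    {s' : ∀ γ (hγ : γ < β), F.obj γ (hγ.trans_le hβ) ⟶ Z'}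
    (h : F.IsColim hβ s) (h' : F.IsColim hβ s') :
    ∃ e : Z ≅ Z', ∀ γ (hγ : γ < β), s γ hγ ≫ e.hom = s' γ hγ := by
  obtain ⟨a, ha⟩ := h.exists_desc s' h'.compatible
  obtain ⟨b, hb⟩ := h'.exists_desc s h.compatible
  refine ⟨⟨a, b, h.hom_ext fun γ hγ => ?_, h'.hom_ext fun γ hγ => ?_⟩, ha⟩
  · rw [← Category.assoc, ha, hb, Category.comp_id]
  · rw [← Category.assoc, hb, ha, Category.comp_id]

lemma Tower.IsColim.of_iso {F : Tower A α} {β : Ordinal.{w}} {hβ : β ≤ α} {Z Z' : A}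
    {s : ∀ γ (hγ : γ < β), F.obj γ (hγ.trans_le hβ) ⟶ Z}
    {s' : ∀ γ (hγ : γ < β), F.obj γ (hγ.trans_le hβ) ⟶ Z'}
    (h : F.IsColim hβ s) (e : Z ≅ Z') (he : ∀ γ (hγ : γ < β), s γ hγ ≫ e.hom = s' γ hγ) :
    F.IsColim hβ s' := by
  obtain rfl : (fun γ hγ => s γ hγ ≫ e.hom) = s' := by
    ext γ hγ; exact he γ hγ
  refine ⟨fun γ δ h' hδ => ?_, fun t ht => ?_, fun {T a b} hab => ?_⟩
  · simp only [← h.compatible γ δ h' hδ, Category.assoc]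
  · obtain ⟨d, hd⟩ := h.exists_desc t ht
    exact ⟨e.inv ≫ d, by simpa using hd⟩
  · rw [← cancel_epi e.hom]
    exact h.hom_ext (by simpa using hab)

/-- The stage `β` of a tower is the colimit of the stages below it. -/
def Tower.IsColimAt (F : Tower A α) (β : Ordinal.{w}) (hβ : β < α) : Prop :=
  F.IsColim hβ.le fun _ hγ => F.map hγ.le hβ

lemma Tower.isCompatible_map (F : Tower A α) {β : Ordinal.{w}} (hβ : β < α) :
    F.IsCompatible hβ.le fun _ hγ => F.map hγ.le hβ :=
  fun _ _ _ _ => F.map_map _ _ _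

/-- All limit stages of the tower are colimits of the preceding stages. -/
def Tower.IsContinuous (F : Tower A α) : Prop :=
  ∀ β (hβ : β < α), Order.IsSuccLimit β → F.IsColimAt β hβ

/-- The successive morphisms of the tower have the property `Q`. -/
def Tower.StepsIn (Q : MorphismProperty A) (F : Tower A α) : Prop :=
  ∀ β (h : Order.succ β < α), Q (F.map (Order.le_succ β) h)

lemma Tower.IsContinuous.restrict {F : Tower A α} (hF : F.IsContinuous) {β : Ordinal.{w}}
    (hβ : β ≤ α) : (F.restrict hβ).IsContinuous :=
  fun γ hγ hlim =>
    have h := hF γ (hγ.trans_le hβ) hlim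
    ⟨h.compatible, h.exists_desc, h.hom_ext⟩

lemma Tower.StepsIn.restrict {Q : MorphismProperty A} {F : Tower A α} (hF : F.StepsIn Q)
    {β : Ordinal.{w}} (hβ : β ≤ α) : (F.restrict hβ).StepsIn Q :=
  fun γ hγ => hF γ (hγ.trans_le hβ)

lemma Tower.StepsIn.mono {Q Q' : MorphismProperty A} {F : Tower A α} (hF : F.StepsIn Q)
    (h : Q ≤ Q') : F.StepsIn Q' :=
  fun β hβ => h _ (hF β hβ)

lemma isSuccLimit_iio_iff (β : Set.Iio α) : Order.IsSuccLimit β ↔ Order.IsSuccLimit β.1 :=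
  (PrincipalSeg.isSuccLimit_apply_iff (Set.principalSegIio α) (a := β)).symm

lemma OrdSystem.isWellOrderContinuous_iff (F : OrdSystem A α) :
    F.IsWellOrderContinuous ↔ F.toTower.IsContinuous := by
  constructor
  · intro hF β hβ hlim
    obtain ⟨hc⟩ := hF.nonempty_isColimit ⟨β, hβ⟩ ((isSuccLimit_iio_iff _).2 hlim)
    refine ⟨F.toTower.isCompatible_map hβ, fun {Z} s hs => ?_, fun {T a b} hab =>
      hc.hom_ext fun γ => hab _ γ.2⟩
    let c : Cocone ((Set.principalSegIio (⟨β, hβ⟩ : Set.Iio α)).monotone.functor ⋙ F) :=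
      { pt := Z
        ι := { app := fun γ => s γ.1.1 γ.2
               naturality := fun γ δ f =>
                (hs _ _ (leOfHom f) δ.2).trans (Category.comp_id _).symm } }
    exact ⟨hc.desc c, fun γ hγ => hc.fac c ⟨⟨γ, hγ.trans hβ⟩, hγ⟩⟩
  · intro hF
    refine ⟨fun β hβ => ?_⟩
    have h := hF β.1 β.2 ((isSuccLimit_iio_iff _).1 hβ)
    have key (c : Cocone ((Set.principalSegIio β).monotone.functor ⋙ F)) :=
      h.exists_desc (fun γ hγ => c.ι.app ⟨⟨γ, hγ.trans β.2⟩, hγ⟩)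
        (fun γ δ h hδ => c.w (j' := ⟨⟨γ, (h.trans_lt hδ).trans β.2⟩, h.trans_lt hδ⟩)
          (j := ⟨⟨δ, hδ.trans β.2⟩, hδ⟩) (homOfLE h))
    exact ⟨{ desc := fun c => (key c).choose
             fac := fun c γ => (key c).choose_spec γ.1.1 γ.2
             uniq := fun c m hm => h.hom_ext fun γ hγ =>
              (hm ⟨⟨γ, _⟩, hγ⟩).trans ((key c).choose_spec γ hγ).symm }⟩

end Tower

section Compositions

variable {A : Type u} [Category.{v} A] [Preadditive A] {E : ExactStructure A} {α : Ordinal.{w}}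

variable (E) in
/-- The class of inflations. -/
def ExactStructure.inflations : MorphismProperty A := fun _ _ i => E.Inflation i

lemma ExactStructure.HasInflationCompositions.exists_isColim (hE : E.HasInflationCompositions α)
    (F : Tower A α) (hF : F.IsContinuous) (hinf : F.StepsIn E.inflations) (hα : 0 < α) :
    ∃ (Z : A) (ι : ∀ β (hβ : β < α), F.obj β hβ ⟶ Z),
      F.IsColim le_rfl ι ∧ E.Inflation (ι 0 hα) := by
  obtain ⟨c, ⟨hc⟩, hc'⟩ := hE F.toSystem (OrdSystem.isWellOrderContinuous_iff _ |>.2 hF) hinf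
  refine ⟨c.pt, fun β hβ => c.ι.app ⟨β, hβ⟩, ⟨fun β γ h hγ => c.w (j' := ⟨β, h.trans_lt hγ⟩)
    (j := ⟨γ, hγ⟩) (homOfLE h), fun {T} s hs => ?_,
    fun {T a b} hab => hc.hom_ext fun γ => hab _ γ.2⟩, hc' hα⟩
  let c' : Cocone F.toSystem :=
    { pt := T
      ι := { app := fun γ => s γ.1 γ.2
             naturality := fun γ δ f =>
              (hs _ _ (leOfHom f) δ.2).trans (Category.comp_id _).symm } }
  exact ⟨hc.desc c', fun β hβ => hc.fac c' _⟩

/-- In a continuous tower of inflations of length at most `l` the morphisms from the `0`-th stage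
are inflations. -/
lemma Tower.inflation_map_zero {l : Ordinal.{w}} (hE : ∀ a ≤ l, E.HasInflationCompositions a)
    (F : Tower A α) (hF : F.IsContinuous) (hinf : F.StepsIn E.inflations)
    (β : Ordinal.{w}) (hβ : β < α) (hβl : β ≤ l) : E.Inflation (F.map (zero_le (a := β)) hβ) := by
  induction β using Ordinal.limitRecOn with
  | zero => rw [F.map_self]; exact E.inflation_id _
  | add_one β ih =>
    have h := (ih ((Order.lt_succ β).trans hβ) ((Order.le_succ β).trans hβl)).comp (hinf β hβ)
    have e := F.map_map (zero_le (a := β)) (Order.le_succ β) hβ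
    exact e ▸ h
  | limit β hlim _ =>
    have h0 : 0 < β := hlim.bot_lt
    obtain ⟨Z, ι, hι, hι0⟩ := (hE β hβl).exists_isColim (F.restrict hβ.le) (hF.restrict _)
      (hinf.restrict _) h0
    have hι' : F.IsColim hβ.le ι := ⟨hι.compatible, hι.exists_desc, hι.hom_ext⟩
    obtain ⟨e, he⟩ := hι'.exists_iso (hF β hβ hlim)
    exact hι0.of_arrow_iso (Iso.refl _) e ((Category.id_comp _).trans (he 0 h0).symm)

end Compositions

section Extension

variable {A : Type u} [Category.{v} A] {α : Ordinal.{w}}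

/-- Extension along a continuous tower: a morphism `M 0 ⟶ G 0` extends to the higher stages
if at every successor step the composite `M β ⟶ G β ⟶ G (β + 1)` extends to `M (β + 1)`. -/
lemma Tower.exists_extension (M G : Tower A α) (h0 : 0 < α) (hM : M.IsContinuous)
    (hstep : ∀ β (hβ : Order.succ β < α) (f : M.obj β ((Order.le_succ β).trans_lt hβ) ⟶
      G.obj β ((Order.le_succ β).trans_lt hβ)), ∃ g : M.obj (Order.succ β) hβ ⟶ G.obj _ hβ,
        M.map (Order.le_succ β) hβ ≫ g = f ≫ G.map (Order.le_succ β) hβ)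
    (f₀ : M.obj 0 h0 ⟶ G.obj 0 h0) (β : Ordinal.{w}) (hβ : β < α) :
    ∃ f : M.obj β hβ ⟶ G.obj β hβ,
      M.map (zero_le (a := β)) hβ ≫ f = f₀ ≫ G.map (zero_le (a := β)) hβ := by
  classical
  let Good (β : Ordinal.{w}) (prev : ∀ γ < β, ∀ h : γ < α, Option (M.obj γ h ⟶ G.obj γ h))
    (hβ : β < α) (f : M.obj β hβ ⟶ G.obj β hβ) : Prop :=
    (M.map (zero_le (a := β)) hβ ≫ f = f₀ ≫ G.map (zero_le (a := β)) hβ) ∧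
    ∀ γ (hγ : γ < β), ∀ g ∈ prev γ hγ (hγ.trans hβ),
      M.map hγ.le hβ ≫ f = g ≫ G.map hγ.le hβ
  let Φ : ∀ β : Ordinal.{w}, ∀ h : β < α, Option (M.obj β h ⟶ G.obj β h) :=
    WellFounded.fix Ordinal.lt_wf fun β prev hβ =>
      if h : ∃ f, Good β prev hβ f then some h.choose else none
  have hΦ (β : Ordinal.{w}) (hβ : β < α) : Φ β hβ =
      if h : ∃ f, Good β (fun γ _ => Φ γ) hβ f then some h.choose else none := by
    simp only [Φ]
    rw [WellFounded.fix_eq]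
  have main (β : Ordinal.{w}) (hβ : β < α) :
      ∃ f ∈ Φ β hβ, Good β (fun γ _ => Φ γ) hβ f := by
    induction β using WellFoundedLT.induction with
    | ind β ih =>
    suffices h : ∃ f, Good β (fun γ _ => Φ γ) hβ f from
      ⟨h.choose, by rw [hΦ, dif_pos h]; rfl, h.choose_spec⟩
    choose φ hφ hφ0 hφ' using ih
    have hφ'' (γ) (hγ : γ < β) (g) (hg : g ∈ Φ γ (hγ.trans hβ)) : g = φ γ hγ (hγ.trans hβ) :=
      Option.mem_unique hg (hφ _ _ _)
    have hcomp (γ δ) (h : γ ≤ δ) (hδ : δ < β) :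
        M.map h (hδ.trans hβ) ≫ φ δ hδ (hδ.trans hβ) =
          φ γ (h.trans_lt hδ) _ ≫ G.map h (hδ.trans hβ) := by
      obtain rfl | h := h.eq_or_lt
      · simp
      · exact hφ' _ _ _ γ h _ (hφ _ _ _)
    obtain rfl | ⟨δ, rfl⟩ | hlim := Ordinal.zero_or_succ_or_isSuccLimit β
    · exact ⟨f₀, by simp, fun γ hγ => absurd hγ not_lt_zero⟩
    · obtain ⟨g, hg⟩ := hstep δ hβ (φ δ (Order.lt_succ δ) _)
      refine ⟨g, ?_, fun γ hγ f hf => ?_⟩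
      · rw [← M.map_map (zero_le (a := δ)) (Order.le_succ δ) hβ, Category.assoc, hg,
          ← Category.assoc, hφ0]
        simp
      · rw [hφ'' γ hγ f hf, ← M.map_map (Order.lt_succ_iff.1 hγ) (Order.le_succ δ) hβ,
          Category.assoc, hg, ← Category.assoc, hcomp]
        simp
    · obtain ⟨d, hd⟩ := (hM β hβ hlim).exists_desc
        (fun γ hγ => φ γ hγ (hγ.trans hβ) ≫ G.map hγ.le hβ) (fun γ δ h hδ => by
          rw [← Category.assoc, hcomp]; simp)
      refine ⟨d, ?_, fun γ hγ f hf => by rw [hφ'' γ hγ f hf, hd]⟩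
      rw [hd 0 hlim.bot_lt]
      simpa using (hφ0 0 hlim.bot_lt h0) =≫ G.map (zero_le (a := β)) hβ
  obtain ⟨f, -, hf, -⟩ := main β hβ
  exact ⟨f, hf⟩

end Extension

/-! ### Transfinite recursion -/

section Recursion

lemma exists_fullyFaithful_cocontinuous (A : Type u) [Category.{v} A] :
    ∃ (T : Type (max u (v + 1) (w + 2))) (_ : Category.{max u v (w + 1)} T) (Φ : A ⥤ T),
      Φ.Full ∧ Φ.Faithful ∧ HasColimitsOfSize.{w + 1, w + 1} T ∧
      PreservesColimitsOfSize.{w + 1, w + 1} Φ := by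
  have h : PreservesLimitsOfSize.{w + 1, w + 1} (uliftCoyoneda.{w + 1} (C := A)) := by
    refine ⟨fun {K} _ => preservesLimitsOfShape_of_evaluation _ _ fun Y => ?_⟩
    exact inferInstanceAs (PreservesLimitsOfShape K (yoneda.obj Y ⋙ uliftFunctor.{w + 1}))
  refine ⟨(A ⥤ Type (max (w + 1) v))ᵒᵖ, inferInstance, (uliftCoyoneda.{w + 1} (C := A)).rightOp,
    inferInstance, inferInstance, inferInstance,
    ⟨fun {K} _ => preservesColimitsOfShape_rightOp _ _⟩⟩

variable {A : Type u} [Category.{v} A] {T : Type*} [Category* T] (Φ : A ⥤ T) [Φ.Full] [Φ.Faithful]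

/-- The restriction to `α` of a functor from the ordinals, as a tower. -/
@[simps]
def _root_.CategoryTheory.Functor.ordinalTower (G : Ordinal.{w} ⥤ T) (α : Ordinal.{w}) :
    Tower T α where
  obj β _ := G.obj β
  map h _ := G.map (homOfLE h)
  map_self _ _ := G.map_id _
  map_map _ _ _ := (G.map_comp _ _).symm

lemma _root_.CategoryTheory.Functor.isContinuous_ordinalTower (G : Ordinal.{w} ⥤ T)
    [G.IsWellOrderContinuous] (α : Ordinal.{w}) : (G.ordinalTower α).IsContinuous := by
  intro β hβ hlim
  let hc := G.isColimitOfIsWellOrderContinuous β hlim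
  refine ⟨(G.ordinalTower α).isCompatible_map hβ, fun {Z} t ht => ?_, fun {Z a b} hab =>
    hc.hom_ext fun γ => hab _ γ.2⟩
  let c : Cocone ((Set.principalSegIio β).monotone.functor ⋙ G) :=
    { pt := Z
      ι := { app := fun γ => t γ.1 γ.2
             naturality := fun γ δ f =>
              (ht _ _ (leOfHom f) δ.2).trans (Category.comp_id _).symm } }
  exact ⟨hc.desc c, fun γ hγ => hc.fac c ⟨γ, hγ⟩⟩

/-- Fully faithful functors reflect colimit stages. -/
lemma isColimAt_of_iso {α : Ordinal.{w}} (F : Tower A α) (G : Tower T α)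
    (e : ∀ β (hβ : β < α), Φ.obj (F.obj β hβ) ≅ G.obj β hβ)
    (he : ∀ β γ (h : β ≤ γ) (hγ : γ < α),
      Φ.map (F.map h hγ) ≫ (e γ hγ).hom = (e β (h.trans_lt hγ)).hom ≫ G.map h hγ)
    {β : Ordinal.{w}} {hβ : β < α} (hG : G.IsColimAt β hβ) : F.IsColimAt β hβ := by
  have he' : ∀ β γ (h : β ≤ γ) (hγ : γ < α),
      G.map h hγ ≫ (e γ hγ).inv = (e β (h.trans_lt hγ)).inv ≫ Φ.map (F.map h hγ) :=
    fun β γ h hγ => by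
      rw [Iso.comp_inv_eq, Category.assoc, he, Iso.inv_hom_id_assoc]
  refine ⟨F.isCompatible_map hβ, fun {Z} t ht => ?_, fun {Z a b} hab => ?_⟩
  · obtain ⟨d, hd⟩ := hG.exists_desc (fun γ hγ => (e γ (hγ.trans hβ)).inv ≫ Φ.map (t γ hγ))
      (fun γ δ h hδ => by
        rw [← Category.assoc, he', Category.assoc, ← Φ.map_comp, ht])
    refine ⟨Φ.preimage ((e β hβ).hom ≫ d), fun γ hγ => Φ.map_injective ?_⟩
    rw [Φ.map_comp, Φ.map_preimage, ← Category.assoc, he, Category.assoc, hd,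
      Iso.hom_inv_id_assoc]
  · refine Φ.map_injective ?_
    rw [← cancel_epi (e β hβ).inv]
    refine hG.hom_ext fun γ hγ => ?_
    simp only [← Category.assoc, he']
    simp only [Category.assoc, ← Φ.map_comp, hab γ hγ]

/-- A functor from the ordinals whose values below `α` lie in the essential image of `Φ` lifts to
a tower. -/
lemma exists_tower_lift (G : Ordinal.{w} ⥤ T) (hG : G.IsWellOrderContinuous)
    (Q : MorphismProperty A) [Q.RespectsIso]
    (hQ : ∀ β, Φ.essImage (G.obj β) → ∃ (X Y : A) (f : X ⟶ Y), Q f ∧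
      Nonempty (Arrow.mk (Φ.map f) ≅ Arrow.mk (G.map (homOfLE (Order.le_succ β)))))
    (α : Ordinal.{w}) (hα : ∀ β < α, Φ.essImage (G.obj β)) :
    ∃ (F : Tower A α) (e : ∀ β (hβ : β < α), Φ.obj (F.obj β hβ) ≅ G.obj β),
      F.IsContinuous ∧ F.StepsIn Q ∧ ∀ β γ (h : β ≤ γ) (hγ : γ < α),
        Φ.map (F.map h hγ) ≫ (e γ hγ).hom = (e β (h.trans_lt hγ)).hom ≫ G.map (homOfLE h) := by
  obtain ⟨F, e, he⟩ : ∃ (F : Tower A α) (e : ∀ β (hβ : β < α), Φ.obj (F.obj β hβ) ≅ G.obj β),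
      ∀ β γ (h : β ≤ γ) (hγ : γ < α),
        Φ.map (F.map h hγ) ≫ (e γ hγ).hom = (e β (h.trans_lt hγ)).hom ≫ G.map (homOfLE h) := by
    choose X e using hα
    let e (β) (hβ : β < α) : Φ.obj (X β hβ) ≅ G.obj β := (e β hβ).some
    exact ⟨
      { obj := X
        map := fun {β γ} h hγ =>
          Φ.preimage ((e β (h.trans_lt hγ)).hom ≫ G.map (homOfLE h) ≫ (e γ hγ).inv)
        map_self := fun {β} h hβ => Φ.map_injective (by
          rw [Subsingleton.elim (homOfLE h) (𝟙 β)]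
          simp)
        map_map := fun {β γ δ} h h' hδ => Φ.map_injective (by
          simp [← G.map_comp_assoc, homOfLE_comp]) }, e, fun β γ h hγ => by simp⟩
  refine ⟨F, e, fun β hβ hlim => ?_, fun β hβ => ?_, he⟩
  · exact isColimAt_of_iso Φ F (G.ordinalTower α) e he (G.isContinuous_ordinalTower α β hβ hlim)
  · obtain ⟨X, Y, f, hf, ⟨i⟩⟩ := hQ β (hα β ((Order.le_succ β).trans_lt hβ))
    have hβ' := (Order.le_succ β).trans_lt hβ
    obtain ⟨i₁, i₂, hi⟩ : ∃ (i₁ : Φ.obj X ≅ G.obj β) (i₂ : Φ.obj Y ≅ G.obj (Order.succ β)),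
        i₁.hom ≫ G.map (homOfLE (Order.le_succ β)) = Φ.map f ≫ i₂.hom :=
      ⟨Arrow.leftFunc.mapIso i, Arrow.rightFunc.mapIso i, i.hom.w⟩
    refine (Q.arrow_mk_iso_iff (Arrow.isoMk (Φ.preimageIso (i₁ ≪≫ (e β hβ').symm))
      (Φ.preimageIso (i₂ ≪≫ (e _ hβ).symm)) (Φ.map_injective ?_))).1 hf
    have h1 := he β _ (Order.le_succ β) hβ
    rw [← cancel_mono (e _ hβ).hom]
    simp [h1, hi]

/-- Transfinite recursion: if every object is the source of a morphism in `Q` and continuous towers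
of morphisms in `Q` have colimits, then every object is the start of a continuous tower of morphisms
in `Q` of any given length. -/
theorem exists_tower (l : Ordinal.{w}) (Q : MorphismProperty A) [Q.RespectsIso]
    (hs : ∀ X : A, ∃ (Y : A) (f : X ⟶ Y), Q f)
    (hc : ∀ β ≤ l, Order.IsSuccLimit β → ∀ F : Tower A β, F.IsContinuous → F.StepsIn Q →
      ∃ (Z : A) (ι : ∀ γ (hγ : γ < β), F.obj γ hγ ⟶ Z), F.IsColim le_rfl ι) (X : A) :
    ∃ F : Tower A (Order.succ l), F.IsContinuous ∧ F.StepsIn Q ∧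
      Nonempty (X ≅ F.obj 0 ((zero_le (a := l)).trans_lt (Order.lt_succ l))) := by
  obtain ⟨T, _, Φ, _, _, _, _⟩ := exists_fullyFaithful_cocontinuous.{w} A
  have hstep (Z : T) : ∃ (Z' : T) (t : Z ⟶ Z'), Φ.essImage Z →
      ∃ (X Y : A) (f : X ⟶ Y), Q f ∧ Nonempty (Arrow.mk (Φ.map f) ≅ Arrow.mk t) := by
    by_cases h : Φ.essImage Z
    · obtain ⟨Y, f, hf⟩ := hs h.witness
      exact ⟨Φ.obj Y, h.getIso.inv ≫ Φ.map f, fun _ =>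
        ⟨_, _, f, hf, ⟨Arrow.isoMk h.getIso (Iso.refl _)⟩⟩⟩
    · exact ⟨Z, 𝟙 Z, fun h' => (h h').elim⟩
  choose Z' t ht using hstep
  let S : SmallObject.SuccStruct T := { X₀ := Φ.obj X, succ := Z', toSucc := t }
  let G := S.iterationFunctor Ordinal.{w}
  have hG : G.IsWellOrderContinuous := inferInstance
  have hQ (β) (hβ : Φ.essImage (G.obj β)) : ∃ (X Y : A) (f : X ⟶ Y), Q f ∧
      Nonempty (Arrow.mk (Φ.map f) ≅ Arrow.mk (G.map (homOfLE (Order.le_succ β)))) := by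
    obtain ⟨X, Y, f, hf, ⟨i⟩⟩ := ht _ hβ
    have hmax : ¬ IsMax β := not_isMax β
    exact ⟨X, Y, f, hf, ⟨i ≪≫ Arrow.isoMk (Iso.refl _) (S.iterationFunctorObjSuccIso β hmax).symm
      (by simpa [G] using S.iterationFunctor_map_succ β hmax)⟩⟩
  have hbot : Nonempty (Φ.obj X ≅ G.obj 0) := ⟨(S.iterationFunctorObjBotIso Ordinal.{w}).symm⟩
  have hess (β : Ordinal.{w}) (hβ : β < Order.succ l) : Φ.essImage (G.obj β) := by
    induction β using WellFoundedLT.induction with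
    | ind β ih =>
    obtain rfl | ⟨δ, rfl⟩ | hlim := Ordinal.zero_or_succ_or_isSuccLimit β
    · exact ⟨X, hbot⟩
    · obtain ⟨X, Y, f, hf, ⟨i⟩⟩ := hQ δ (ih δ (Order.lt_succ δ) ((Order.lt_succ δ).trans hβ))
      exact ⟨Y, ⟨Arrow.rightFunc.mapIso i⟩⟩
    · obtain ⟨F, e, hF, hFQ, he⟩ := exists_tower_lift Φ G hG Q hQ β
        fun γ hγ => ih γ hγ (hγ.trans hβ)
      obtain ⟨Z, ι, hι⟩ := hc β (Order.lt_succ_iff.1 hβ) hlim F hF hFQ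
      let c : Cocone F.toSystem :=
        { pt := Z
          ι := { app := fun γ => ι γ.1 γ.2
                 naturality := fun γ δ f =>
                  (hι.compatible _ _ (leOfHom f) δ.2).trans (Category.comp_id _).symm } }
      have key (s : Cocone F.toSystem) := hι.exists_desc (fun γ hγ => s.ι.app ⟨γ, hγ⟩)
        fun γ δ h hδ => s.w (j' := ⟨γ, h.trans_lt hδ⟩) (j := ⟨δ, hδ⟩) (homOfLE h)
      let hc : IsColimit c :=
        { desc := fun s => (key s).choose
          fac := fun s γ => (key s).choose_spec γ.1 γ.2
          uniq := fun s m hm => hι.hom_ext fun γ hγ =>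
            (hm ⟨γ, hγ⟩).trans ((key s).choose_spec γ hγ).symm }
      let i : F.toSystem ⋙ Φ ≅ (Set.principalSegIio β).monotone.functor ⋙ G :=
        NatIso.ofComponents (fun γ => e γ.1 γ.2) fun {γ δ} f => he γ.1 δ.1 (leOfHom f) δ.2
      exact ⟨Z, ⟨(isColimitOfPreserves Φ hc).coconePointsIsoOfNatIso
        (G.isColimitOfIsWellOrderContinuous β hlim) i⟩⟩
  obtain ⟨F, e, hF, hFQ, -⟩ := exists_tower_lift Φ G hG Q hQ (Order.succ l) hess
  exact ⟨F, hF, hFQ, ⟨Φ.preimageIso (hbot.some ≪≫ (e 0 _).symm)⟩⟩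

end Recursion

/-! ### Filtrations -/

section Filtrations

variable {A : Type u} [Category.{v} A] [Preadditive A] {E : ExactStructure A} {α l : Ordinal.{w}}

variable (E) in
/-- The inflations with cokernel in `P`. -/
def ExactStructure.inflationsWithCokernelIn (P : ObjectProperty A) : MorphismProperty A :=
  fun _ Y f => ∃ (W : A) (p : Y ⟶ W), P W ∧ IsConfl E f p

lemma ExactStructure.inflationsWithCokernelIn_le (P : ObjectProperty A) :
    E.inflationsWithCokernelIn P ≤ E.inflations :=
  fun _ _ _ ⟨_, _, _, h⟩ => h.inflation

lemma ExactStructure.inflationsWithCokernelIn_mono {P P' : ObjectProperty A} (h : P ≤ P') :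
    E.inflationsWithCokernelIn P ≤ E.inflationsWithCokernelIn P' :=
  fun _ _ _ ⟨W, p, hW, hp⟩ => ⟨W, p, h _ hW, hp⟩

instance (P : ObjectProperty A) : (E.inflationsWithCokernelIn P).RespectsIso :=
  MorphismProperty.RespectsIso.of_respects_arrow_iso _ fun _ _ e ⟨W, p, hW, hp⟩ =>
    ⟨W, (Arrow.rightFunc.mapIso e).inv ≫ p, hW, hp.of_isos (Arrow.leftFunc.mapIso e)
      (Arrow.rightFunc.mapIso e) (Iso.refl W) e.hom.w
      (((Arrow.rightFunc.mapIso e).hom_inv_id_assoc p).trans (Category.comp_id p).symm)⟩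

instance (J : MorphismIdeal A) : J.toProperty.RespectsIso :=
  MorphismProperty.RespectsIso.mk _
    (fun e f hf => by simpa [MorphismIdeal.toProperty] using J.comp_mem e.hom (𝟙 _) hf)
    (fun e f hf => by simpa [MorphismIdeal.toProperty] using J.comp_mem (𝟙 _) e.hom hf)

lemma ExactStructure.filt_iff {P : ObjectProperty A} {C : A} :
    E.Filt α P C ↔ ∃ F : Tower A (Order.succ α), F.IsContinuous ∧
      IsZero (F.obj 0 ((zero_le (a := α)).trans_lt (Order.lt_succ α))) ∧
      F.StepsIn (E.inflationsWithCokernelIn P) ∧ Nonempty (F.obj α (Order.lt_succ α) ≅ C) := by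
  constructor
  · rintro ⟨F, hF, h0, hs, hC⟩
    refine ⟨F.toTower, F.isWellOrderContinuous_iff.1 hF, h0, fun β hβ => ?_, hC⟩
    obtain ⟨W, p, hp, hW, hc⟩ := hs β hβ
    exact ⟨W, p, hW, hp, hc⟩
  · rintro ⟨F, hF, h0, hs, hC⟩
    refine ⟨F.toSystem, F.toSystem.isWellOrderContinuous_iff.2 hF, h0, fun β hβ => ?_, hC⟩
    obtain ⟨W, p, hW, hp, hc⟩ := hs β hβ
    exact ⟨W, p, hp, hW, hc⟩

lemma ExactStructure.filt_mono {P P' : ObjectProperty A} (h : P ≤ P') :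
    E.Filt α P ≤ E.Filt α P' := by
  intro C hC
  rw [E.filt_iff] at hC ⊢
  obtain ⟨F, hF, h0, hs, hC⟩ := hC
  exact ⟨F, hF, h0, hs.mono (E.inflationsWithCokernelIn_mono h), hC⟩

/-- The cokernel of a transfinite composition of inflations is filtered by the cokernels of the
individual inflations. -/
lemma Tower.exists_isConfl_filt (hE : ∀ a ≤ l, E.HasInflationCompositions a)
    {P : ObjectProperty A} (F : Tower A (Order.succ l)) (hF : F.IsContinuous)
    (hs : F.StepsIn (E.inflationsWithCokernelIn P)) :
    ∃ (C : A) (p : F.obj l (Order.lt_succ l) ⟶ C),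
      IsConfl E (F.map (zero_le (a := l)) (Order.lt_succ l)) p ∧ E.Filt l P C := by
  have hinf (β) (hβ : β < Order.succ l) := (F.inflation_map_zero hE hF
    (hs.mono (E.inflationsWithCokernelIn_le P)) β hβ (Order.lt_succ_iff.1 hβ)).exists_isConfl
  choose C p hp using hinf
  have hepi (β) (hβ : β < Order.succ l) : Epi (p β hβ) := (hp β hβ).isCoker.epi
  have key (β γ) (h : β ≤ γ) (hγ : γ < Order.succ l) :=
    (hp β (h.trans_lt hγ)).isCoker.exists_desc (F.map h hγ ≫ p γ hγ) (by simp [(hp γ hγ).1])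
  choose c hc using key
  let T : Tower A (Order.succ l) :=
    { obj := C
      map := fun h hγ => c _ _ h hγ
      map_self := fun {β} h hβ => by
        rw [← cancel_epi (p β hβ), hc]; simp
      map_map := fun {β γ δ} h h' hδ => by
        rw [← cancel_epi (p β _), reassoc_of% hc, hc, hc]; simp }
  have hT (β γ) (h : β ≤ γ) (hγ : γ < Order.succ l) :
      p β (h.trans_lt hγ) ≫ T.map h hγ = F.map h hγ ≫ p γ hγ := hc β γ h hγ
  have hp0 (β) (hβ : β < Order.succ l) : F.map (zero_le (a := β)) hβ ≫ p β hβ = 0 := (hp β hβ).1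
  refine ⟨C l (Order.lt_succ l), p l (Order.lt_succ l), hp _ _,
    E.filt_iff.2 ⟨T, fun β hβ hlim => ?_, ?_, fun β hβ => ?_, ⟨Iso.refl _⟩⟩⟩
  · have hβF := hF β hβ hlim
    refine ⟨T.isCompatible_map hβ, fun {Z} t ht => ?_, fun {Z a b} hab => ?_⟩
    · obtain ⟨d, hd⟩ := hβF.exists_desc (fun γ hγ => p γ (hγ.trans hβ) ≫ t γ hγ)
        (fun γ δ h hδ => by
          rw [← Category.assoc, ← hT, Category.assoc, ht])
      obtain ⟨d', hd'⟩ := (hp β hβ).isCoker.exists_desc d (by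
        rw [hd 0 hlim.bot_lt]
        have h00 := hp0 0 (hlim.bot_lt.trans hβ)
        rw [F.map_self, Category.id_comp] at h00
        rw [h00, zero_comp])
      refine ⟨d', fun γ hγ => ?_⟩
      rw [← cancel_epi (p γ (hγ.trans hβ)), ← Category.assoc, hT, Category.assoc, hd', hd]
    · rw [← cancel_epi (p β hβ)]
      refine hβF.hom_ext fun γ hγ => ?_
      rw [← Category.assoc, ← Category.assoc, ← hT γ β hγ.le hβ, Category.assoc, Category.assoc,
        hab γ hγ]
  · have h00 := hp0 0 ((zero_le (a := l)).trans_lt (Order.lt_succ l))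
    rw [F.map_self, Category.id_comp] at h00
    rw [IsZero.iff_id_eq_zero]
    change 𝟙 (C 0 _) = 0
    rw [← cancel_epi (p 0 _), h00, zero_comp, zero_comp]
  · obtain ⟨W, r, hW, hr⟩ := hs β hβ
    have h1 := (hp (Order.succ β) hβ).isCoker
    rw [← F.map_map (zero_le (a := β)) (Order.le_succ β) hβ] at h1
    obtain ⟨d, -, hd⟩ := IsConfl.noether (hp β _).isCoker h1 hr (T.map (Order.le_succ β) hβ)
      (hT _ _ _ _)
    exact ⟨W, d, hW, hd⟩

/-- In an extension of towers `X ⟶ T ⟶ C` with constant kernel, the limit stages of `T` are colimits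
if those of `C` are and `T` is a tower of inflations. -/
lemma Tower.isColimAt_of_isConfl {X : A} {T C : Tower A α} (h0 : 0 < α)
    (ι : ∀ β (hβ : β < α), X ⟶ T.obj β hβ) (q : ∀ β (hβ : β < α), T.obj β hβ ⟶ C.obj β hβ)
    (hι : ∀ β γ (h : β ≤ γ) (hγ : γ < α), ι β (h.trans_lt hγ) ≫ T.map h hγ = ι γ hγ)
    (hq : ∀ β γ (h : β ≤ γ) (hγ : γ < α), T.map h hγ ≫ q γ hγ = q β (h.trans_lt hγ) ≫ C.map h hγ)
    (hιq : ∀ β (hβ : β < α), IsConfl E (ι β hβ) (q β hβ)) (hC0 : IsZero (C.obj 0 h0))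
    {β : Ordinal.{w}} (hβ : β < α) (hβ0 : 0 < β) (hE : E.HasInflationCompositions β)
    (hT : (T.restrict hβ.le).IsContinuous) (hTs : T.StepsIn E.inflations)
    (hCβ : C.IsColimAt β hβ) : T.IsColimAt β hβ := by
  have hqepi (γ) (hγ : γ < α) : Epi (q γ hγ) := (hιq γ hγ).isCoker.epi
  have hiso0 : IsIso (ι 0 h0) := (hιq 0 h0).isKer.isIso_of_isZero hC0
  obtain ⟨Z, κ, hκ, hκ0⟩ : ∃ (Z : A) (κ : ∀ γ (hγ : γ < β), T.obj γ (hγ.trans hβ) ⟶ Z),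
      T.IsColim hβ.le κ ∧ E.Inflation (κ 0 hβ0) := by
    obtain ⟨Z, κ, hκ, hκ0⟩ := hE.exists_isColim (T.restrict hβ.le) hT (hTs.restrict hβ.le) hβ0
    exact ⟨Z, κ, ⟨hκ.compatible, hκ.exists_desc, hκ.hom_ext⟩, hκ0⟩
  have hικ (γ) (hγ : γ < β) : ι 0 h0 ≫ κ 0 hβ0 = ι γ (hγ.trans hβ) ≫ κ γ hγ := by
    rw [← hκ.compatible 0 γ zero_le hγ, ← Category.assoc, hι]
  obtain ⟨q', hq'⟩ := hκ.exists_desc (fun γ hγ => q γ (hγ.trans hβ) ≫ C.map hγ.le hβ)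
    (fun γ δ h hδ => by rw [← Category.assoc, hq]; simp)
  have hcoker : IsCoker (ι 0 h0 ≫ κ 0 hβ0) q' := by
    refine ⟨?_, ⟨fun a b hab => ?_⟩, fun {T'} k hk => ?_⟩
    · rw [Category.assoc, hq', ← Category.assoc, (hιq 0 h0).1, zero_comp]
    · refine hCβ.hom_ext fun γ hγ => ?_
      rw [← cancel_epi (q γ (hγ.trans hβ)), ← Category.assoc, ← Category.assoc, ← hq' γ hγ,
        Category.assoc, Category.assoc,
        hab]
    · have key (γ) (hγ : γ < β) := (hιq γ (hγ.trans hβ)).isCoker.exists_desc (κ γ hγ ≫ k) (by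
        rw [← Category.assoc, ← hικ, hk])
      choose t ht using key
      obtain ⟨d, hd⟩ := hCβ.exists_desc t (fun γ δ h hδ => by
        rw [← cancel_epi (q γ _), ← Category.assoc, ← hq, Category.assoc, ht, ht,
          ← Category.assoc, hκ.compatible])
      refine ⟨d, hκ.hom_ext fun γ hγ => ?_⟩
      rw [← Category.assoc, hq', Category.assoc, hd, ht]
  have hconfl : IsConfl E (ι 0 h0 ≫ κ 0 hβ0) q' :=
    ((E.inflation_of_isIso (ι 0 h0)).comp hκ0).isConfl hcoker
  obtain ⟨b, hb⟩ := hκ.exists_desc _ (T.isCompatible_map hβ)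
  have hbiso : IsIso b := by
    refine hconfl.isIso_of_comp_eq (hιq β hβ) b ?_ (hκ.hom_ext fun γ hγ => ?_)
    · rw [Category.assoc, hb, hι]
    · rw [← Category.assoc, hb, hq, hq']
  exact hκ.of_iso (asIso b) hb

/-- Pulling back a conflation along a filtration of its cokernel yields a continuous tower. -/
lemma Tower.exists_pullback (hE : ∀ a ≤ l, E.HasInflationCompositions a) {P : ObjectProperty A}
    (C : Tower A (Order.succ l)) (hC : C.IsContinuous)
    (hC0 : IsZero (C.obj 0 ((zero_le (a := l)).trans_lt (Order.lt_succ l))))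
    (hs : C.StepsIn (E.inflationsWithCokernelIn P)) {X N : A} {i : X ⟶ N}
    {p : N ⟶ C.obj l (Order.lt_succ l)} (hip : IsConfl E i p) :
    ∃ (M : Tower A (Order.succ l))
      (e₀ : X ≅ M.obj 0 ((zero_le (a := l)).trans_lt (Order.lt_succ l)))
      (e₁ : M.obj l (Order.lt_succ l) ≅ N),
      M.IsContinuous ∧ M.StepsIn (E.inflationsWithCokernelIn P) ∧
      e₀.hom ≫ M.map (zero_le (a := l)) (Order.lt_succ l) ≫ e₁.hom = i := by
  have hpb (β) (hβ : β < Order.succ l) := E.deflation_pullback p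
    (C.map (Order.lt_succ_iff.1 hβ) (Order.lt_succ l)) hip.deflation
  choose M g q sq hq using hpb
  have hI (β) (hβ : β < Order.succ l) := hip.of_isPullback (sq β hβ)
  choose ι hιg hι using hI
  let T : Tower A (Order.succ l) :=
    { obj := M
      map := fun {β γ} h hγ => (sq γ hγ).lift (g β _) (q β _ ≫ C.map h hγ) (by
        rw [(sq β _).w]; simp)
      map_self := fun {β} h hβ => (sq β hβ).hom_ext (by simp) (by simp)
      map_map := fun {β γ δ} h h' hδ => (sq δ hδ).hom_ext (by simp) (by simp) }
  have hTg (β γ) (h : β ≤ γ) (hγ : γ < Order.succ l) :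
      T.map h hγ ≫ g γ hγ = g β _ := (sq γ hγ).lift_fst _ _ _
  have hTq (β γ) (h : β ≤ γ) (hγ : γ < Order.succ l) :
      T.map h hγ ≫ q γ hγ = q β _ ≫ C.map h hγ := (sq γ hγ).lift_snd _ _ _
  have hιT (β γ) (h : β ≤ γ) (hγ : γ < Order.succ l) :
      ι β (h.trans_lt hγ) ≫ T.map h hγ = ι γ hγ := (sq γ hγ).hom_ext
    (by rw [Category.assoc, hTg, hιg, hιg])
    (by rw [Category.assoc, hTq, ← Category.assoc, (hι β _).1, (hι γ _).1, zero_comp])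
  have hTsq (β γ) (h : β ≤ γ) (hγ : γ < Order.succ l) :
      IsPullback (T.map h hγ) (q β (h.trans_lt hγ)) (q γ hγ) (C.map h hγ) := by
    refine IsPullback.of_right ?_ (hTq β γ h hγ) (sq γ hγ)
    rw [hTg, C.map_map]
    exact sq β _
  have hsteps : T.StepsIn (E.inflationsWithCokernelIn P) := fun β hβ => by
    obtain ⟨W, d, hW, hd⟩ := hs β hβ
    exact ⟨W, _, hW, hd.of_isPullback_inflation (hι _ hβ).deflation (hTsq _ _ _ hβ)⟩
  have h0 : (0 : Ordinal.{w}) < Order.succ l := (zero_le (a := l)).trans_lt (Order.lt_succ l)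
  have hiso0 : IsIso (ι 0 h0) := (hι 0 h0).isKer.isIso_of_isZero hC0
  have hcont : T.IsContinuous := by
    intro β
    induction β using WellFoundedLT.induction with
    | ind β ih =>
    intro hβ hlim
    exact Tower.isColimAt_of_isConfl h0 ι q hιT hTq hι hC0 hβ hlim.bot_lt
      (hE β (Order.lt_succ_iff.1 hβ)) (fun γ hγ hγl =>
        have h := ih γ hγ (hγ.trans hβ) hγl
        ⟨h.compatible, h.exists_desc, h.hom_ext⟩)
      (hsteps.mono (E.inflationsWithCokernelIn_le P)) (hC β hβ hlim)
  have hgl : IsIso (g l (Order.lt_succ l)) := by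
    have h := sq l (Order.lt_succ l)
    rw [C.map_self] at h
    exact h.isIso_fst_of_isIso
  refine ⟨T, asIso (ι 0 h0), asIso (g l (Order.lt_succ l)), hcont, hsteps, ?_⟩
  simp only [asIso_hom]
  rw [← Category.assoc, hιT, hιg]

end Filtrations

/-! ### The left orthogonal class of the inductive power -/

section Perp

variable {A : Type u} [Category.{v} A] [Preadditive A] {E : ExactStructure A} {l : Ordinal.{w}}

variable (E) in
/-- The ideal of all morphisms `m` with `Ext(C, m) = 0`. -/
def extAnnihilator (C : A) : MorphismIdeal A where
  hom X X' :=
    { carrier := {m | ∀ ⦃Y : A⦄ (i : X ⟶ Y) (p : Y ⟶ C), IsConfl E i p → ∃ h : Y ⟶ X', i ≫ h = m}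
      zero_mem' := fun _ _ _ _ => ⟨0, by simp⟩
      add_mem' := fun hm hm' _ i p hip => by
        obtain ⟨h, hh⟩ := hm i p hip
        obtain ⟨h', hh'⟩ := hm' i p hip
        exact ⟨h + h', by simp [hh, hh']⟩
      neg_mem' := fun hm _ i p hip => by
        obtain ⟨h, hh⟩ := hm i p hip
        exact ⟨-h, by simp [hh]⟩ }
  comp_mem := by
    intro _ _ _ _ f g k hg Y i p hip
    obtain ⟨Y', f', i', sq, -⟩ := E.inflation_pushout i f hip.inflation
    obtain ⟨p', -, hp'⟩ := hip.of_isPushout sq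
    obtain ⟨h, hh⟩ := hg i' p' hp'
    exact ⟨f' ≫ h ≫ k, by rw [reassoc_of% sq.w, reassoc_of% hh]⟩

lemma ob_leftPerp_iff_le {M : MorphismProperty A} {W : A} :
    Ob (leftPerp E M) W ↔ M ≤ (extAnnihilator E W).toProperty :=
  ob_leftPerp_iff.trans ⟨fun h _ _ m hm => h m hm, fun h _ _ m hm => h m hm⟩

/-- An object with an `l`-filtration by objects of `⊥J` is in `⊥(J^(l))`. -/
theorem filt_ob_leftPerp_le (hE : ∀ a ≤ l, E.HasInflationCompositions a) (J : MorphismIdeal A) :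
    E.Filt l (Ob (leftPerp E J.toProperty)) ≤
      Ob (leftPerp E (J.inductivePower l).toProperty) := by
  intro D hD
  obtain ⟨C, hC, hC0, hs, ⟨e⟩⟩ := E.filt_iff.1 hD
  refine ob_leftPerp_iff_le.2 fun X X' m hm => hm _ ?_
  rintro X X' m ⟨G', -, hG', ⟨a⟩⟩ N i p hip
  let G := G'.toTower
  have hG : G.StepsIn J.toProperty := hG'
  obtain ⟨a₀, a₁, ha⟩ : ∃ (a₀ : X ≅ G.obj 0 ((zero_le (a := l)).trans_lt (Order.lt_succ l)))
      (a₁ : X' ≅ G.obj l (Order.lt_succ l)),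
      a₀.hom ≫ G.map (zero_le (a := l)) (Order.lt_succ l) = m ≫ a₁.hom :=
    ⟨Arrow.leftFunc.mapIso a, Arrow.rightFunc.mapIso a, a.hom.w⟩
  have hip' : IsConfl E i (p ≫ e.inv) :=
    hip.of_isos (Iso.refl _) (Iso.refl _) e.symm (by simp) (by simp)
  obtain ⟨M, e₀, e₁, hM, hMs, hi⟩ := C.exists_pullback hE hC hC0 hs hip'
  obtain ⟨f, hf⟩ := M.exists_extension G _ hM (fun β hβ f => by
    obtain ⟨W, r, hW, hr⟩ := hMs β hβ
    refine ob_leftPerp_iff.1 hW _ ?_ _ r hr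
    simpa [MorphismIdeal.toProperty] using J.comp_mem f (𝟙 _) (hG β hβ)) (e₀.inv ≫ a₀.hom) l
    (Order.lt_succ l)
  refine ⟨e₁.inv ≫ f ≫ a₁.inv, ?_⟩
  rw [← hi]
  simp [reassoc_of% hf, reassoc_of% ha]

end Perp

/-! ### Closure under finite direct sums -/

section Sums

variable {A : Type u} [Category.{v} A] [Preadditive A] {E : ExactStructure A} {α : Ordinal.{w}}

lemma ExactStructure.filt_of_iso {P : ObjectProperty A} {C D : A} (e : C ≅ D)
    (hC : E.Filt α P C) : E.Filt α P D := by
  obtain ⟨F, hF, h0, hs, ⟨i⟩⟩ := hC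
  exact ⟨F, hF, h0, hs, ⟨i ≪≫ e⟩⟩

lemma ExactStructure.filt_of_isZero {P : ObjectProperty A} {C : A} (hC : IsZero C) (hP : P C) :
    E.Filt α P C := by
  let F : Tower A (Order.succ α) :=
    { obj := fun _ _ => C
      map := fun _ _ => 𝟙 C
      map_self := fun _ _ => rfl
      map_map := fun _ _ _ => Category.id_comp _ }
  exact E.filt_iff.2 ⟨F, fun β hβ _ => ⟨F.isCompatible_map hβ,
    fun _ _ => ⟨0, fun _ _ => hC.eq_of_src _ _⟩, fun _ => hC.eq_of_src _ _⟩, hC,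
    fun _ _ => ⟨C, 0, hP, isConfl_of_isZero hC hC hC _ _⟩, ⟨Iso.refl _⟩⟩

/-- The direct sum of two towers. -/
@[simps]
noncomputable def Tower.biprod [HasBinaryBiproducts A] (F G : Tower A α) : Tower A α where
  obj β hβ := F.obj β hβ ⊞ G.obj β hβ
  map h hγ := Limits.biprod.map (F.map h hγ) (G.map h hγ)
  map_self _ _ := by ext <;> simp
  map_map _ _ _ := by ext <;> simp

lemma Tower.IsContinuous.biprod [HasBinaryBiproducts A] {F G : Tower A α} (hF : F.IsContinuous)
    (hG : G.IsContinuous) : (F.biprod G).IsContinuous := by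
  intro β hβ hlim
  have hF := hF β hβ hlim
  have hG := hG β hβ hlim
  let inl (γ) (hγ : γ < α) : F.obj γ hγ ⟶ (F.biprod G).obj γ hγ := biprod.inl
  let inr (γ) (hγ : γ < α) : G.obj γ hγ ⟶ (F.biprod G).obj γ hγ := biprod.inr
  have hinl (γ δ) (h : γ ≤ δ) (hδ : δ < α) :
      F.map h hδ ≫ inl δ hδ = inl γ _ ≫ (F.biprod G).map h hδ := (biprod.inl_map _ _).symm
  have hinr (γ δ) (h : γ ≤ δ) (hδ : δ < α) :
      G.map h hδ ≫ inr δ hδ = inr γ _ ≫ (F.biprod G).map h hδ := (biprod.inr_map _ _).symm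
  have hext (γ) (hγ : γ < α) {Z : A} {a b : (F.biprod G).obj γ hγ ⟶ Z}
      (h₁ : inl γ hγ ≫ a = inl γ hγ ≫ b) (h₂ : inr γ hγ ≫ a = inr γ hγ ≫ b) : a = b :=
    biprod.hom_ext' _ _ h₁ h₂
  refine ⟨(F.biprod G).isCompatible_map hβ, fun {Z} t ht => ?_, fun {Z a b} hab => ?_⟩
  · obtain ⟨d, hd⟩ := hF.exists_desc (fun γ hγ => inl γ (hγ.trans hβ) ≫ t γ hγ)
      (fun γ δ h hδ => by rw [← Category.assoc, hinl, Category.assoc, ht])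
    obtain ⟨d', hd'⟩ := hG.exists_desc (fun γ hγ => inr γ (hγ.trans hβ) ≫ t γ hγ)
      (fun γ δ h hδ => by rw [← Category.assoc, hinr, Category.assoc, ht])
    obtain ⟨D, hD, hD'⟩ : ∃ D : (F.biprod G).obj β hβ ⟶ Z, inl β hβ ≫ D = d ∧ inr β hβ ≫ D = d' :=
      ⟨biprod.desc d d', biprod.inl_desc _ _, biprod.inr_desc _ _⟩
    refine ⟨D, fun γ hγ => hext γ _ ?_ ?_⟩
    · rw [← Category.assoc, ← hinl, Category.assoc, hD, hd]
    · rw [← Category.assoc, ← hinr, Category.assoc, hD', hd']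
  · refine hext β hβ (hF.hom_ext fun γ hγ => ?_) (hG.hom_ext fun γ hγ => ?_)
    · rw [← Category.assoc, ← Category.assoc, hinl, Category.assoc, Category.assoc,
        hab γ hγ]
    · rw [← Category.assoc, ← Category.assoc, hinr, Category.assoc, Category.assoc,
        hab γ hγ]

lemma prop_biprod [HasBinaryBiproducts A] (P : ObjectProperty A) [P.IsClosedUnderFiniteProducts]
    {X Y : A} (hX : P X) (hY : P Y) : P (X ⊞ Y) :=
  P.prop_of_isLimit (BinaryBiproduct.isLimit X Y) (by rintro ⟨_ | _⟩ <;> assumption)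

lemma ExactStructure.filt_biprod [HasBinaryBiproducts A] {P : ObjectProperty A}
    [P.IsClosedUnderFiniteProducts] {C D : A} (hC : E.Filt α P C) (hD : E.Filt α P D) :
    E.Filt α P (C ⊞ D) := by
  rw [E.filt_iff] at hC hD ⊢
  obtain ⟨F, hF, hF0, hFs, ⟨i⟩⟩ := hC
  obtain ⟨G, hG, hG0, hGs, ⟨j⟩⟩ := hD
  refine ⟨F.biprod G, hF.biprod hG, ?_, fun β hβ => ?_, ⟨biprod.mapIso i j⟩⟩
  · rw [IsZero.iff_id_eq_zero]
    exact biprod.hom_ext' _ _ (hF0.eq_of_src _ _) (hG0.eq_of_src _ _)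
  · obtain ⟨W, p, hW, hp⟩ := hFs β hβ
    obtain ⟨W', p', hW', hp'⟩ := hGs β hβ
    exact ⟨W ⊞ W', _, prop_biprod P hW hW', hp.biprod hp'⟩

lemma ExactStructure.filt_isClosedUnderFiniteProducts [HasFiniteBiproducts A]
    (P : ObjectProperty A) [P.IsClosedUnderFiniteProducts] :
    (E.Filt α P).IsClosedUnderFiniteProducts := by
  have := HasBinaryBiproducts.of_hasBinaryProducts (C := A)
  have : (E.Filt α P).IsClosedUnderIsomorphisms := ⟨fun e h => E.filt_of_iso e h⟩
  have : (E.Filt α P).ContainsZero := by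
    obtain ⟨Z, hZ⟩ := HasZeroObject.zero (C := A)
    exact ⟨Z, hZ, E.filt_of_isZero hZ (P.prop_of_isTerminal _ hZ.isTerminal)⟩
  have : (E.Filt α P).IsClosedUnderBinaryProducts := by
    refine ⟨?_⟩
    rintro X ⟨p⟩
    exact E.filt_of_iso (IsLimit.conePointsIsoOfNatIso (BinaryBiproduct.isLimit _ _) p.isLimit
      (diagramIsoPair p.diag).symm) (E.filt_biprod (p.prop_diag_obj ⟨.left⟩)
        (p.prop_diag_obj ⟨.right⟩))
  exact ObjectProperty.IsClosedUnderFiniteProducts.mk'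

end Sums

/-! ### Cosyzygies for the inductive power -/

/-- If `P` contains a `J`-cosyzygy of every object, then `l-Filt(P)` contains a `J^(l)`-cosyzygy of
every object. -/
theorem exists_isCosyzygy_inductivePower {A : Type u} [Category.{v} A] [Preadditive A]
    {E : ExactStructure A} {l : Ordinal.{w}} (hE : ∀ a ≤ l, E.HasInflationCompositions a)
    {J : MorphismIdeal A} {P : ObjectProperty A}
    (hP : ∀ X : A, ∃ W : A, P W ∧ IsCosyzygy E J X W) (X : A) :
    ∃ W : A, E.Filt l P W ∧ IsCosyzygy E (J.inductivePower l) X W := by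
  let Q : MorphismProperty A :=
    J.toProperty ⊓ E.inflationsWithCokernelIn (P ⊓ Ob (leftPerp E J.toProperty))
  have hQinf : Q ≤ E.inflations := inf_le_right.trans (E.inflationsWithCokernelIn_le _)
  obtain ⟨F, hF, hFQ, ⟨e⟩⟩ := exists_tower l Q
    (fun X => by
      obtain ⟨W, hW, hW', ξ, hξ⟩ := hP X
      exact ⟨ξ.mid, ξ.i, hξ, W, ξ.p, ⟨hW, hW'⟩, ξ.isConfl⟩)
    (fun β hβ hlim F hF hFQ => by
      obtain ⟨Z, ι, hι, -⟩ := (hE β hβ).exists_isColim F hF (hFQ.mono hQinf) hlim.bot_lt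
      exact ⟨Z, ι, hι⟩) X
  obtain ⟨C, p, hp, hC⟩ := F.exists_isConfl_filt hE hF (hFQ.mono inf_le_right)
  have hp' : IsConfl E (e.hom ≫ F.map (zero_le (a := l)) (Order.lt_succ l)) p :=
    hp.of_isos e.symm (Iso.refl _) (Iso.refl _) (by simp) (by simp)
  refine ⟨C, E.filt_mono inf_le_left _ hC,
    filt_ob_leftPerp_le hE J _ (E.filt_mono inf_le_right _ hC), hp'.toConflation, fun I hI => ?_⟩
  exact hI _ ⟨F.toSystem, F.toSystem.isWellOrderContinuous_iff.2 hF, fun β hβ => (hFQ β hβ).1,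
    ⟨Arrow.isoMk e (Iso.refl _) (Category.comp_id _).symm⟩⟩

end IdealApprox

theorem theorem6p2 {A : Type u} [CategoryTheory.Category.{v} A]
    [CategoryTheory.Preadditive A] [CategoryTheory.Limits.HasFiniteBiproducts A]
    (E : IdealApprox.ExactStructure A) (l : Ordinal.{w}) (hl : Ordinal.omega0 ≤ l)
    (hE : ∀ a : Ordinal.{w}, a ≤ l → E.HasInflationCompositions a)
    (J : IdealApprox.MorphismIdeal A)
    (hJ : IdealApprox.IsObjectSpecialPreenveloping E J)
    (P : CategoryTheory.ObjectProperty A)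
    (hP : IdealApprox.IsCosyzygySubcategory E J P) :
    IdealApprox.IsObjectSpecialPreenveloping E (J.inductivePower l) ∧
    IdealApprox.IsCosyzygySubcategory E (J.inductivePower l) (E.Filt l P) ∧
    (P ≤ IdealApprox.Ob (IdealApprox.leftPerp E J.toProperty) →
      E.Filt l P ≤
        IdealApprox.Ob (IdealApprox.leftPerp E (J.inductivePower l).toProperty)) := by
  have key := IdealApprox.exists_isCosyzygy_inductivePower hE hP.2
  have := hP.1
  exact ⟨fun X => (key X).imp fun W h => h.2, ⟨E.filt_isClosedUnderFiniteProducts P, key⟩,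
    fun h => (E.filt_mono h).trans (IdealApprox.filt_ob_leftPerp_le hE J)⟩
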